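/- **Conventions.** A relational signature is a nonempty collection of relation symbols, each with an arity at least $1$. A structure $\mathbb A$ in a signature has a finite universe $A$ with at least two elements and interprets each symbol $R$ of arity $n$ by a nonempty proper relation $\emptyset\subsetneq R^{\mathbb A}\subsetneq A^{n}$. For $\mathcal L\subseteq\{\exists,\forall,\wedge,\vee,=,\neq,\neg\}$, an $\mathcal L$-sentence is a first-order sentence in the given signature whose connectives, quantifiers and (dis)equality symbols all lie in $\mathcal L$. A pair $(\mathbb A,\mathbb B)$ of structures in the same signature is an $\mathcal L$-PMC template if every $\mathcal L$-sentence true in $\mathbb A$ is true in $\mathbb B$. For such a template, $\mathcal L\text{-}\mathrm{PMC}(\mathbb A,\mathbb B)$ is the promise problem whose instances are $\mathcal L$-sentences $\phi$ (written as words over a finite alphabet, each relation symbol being written by means of a fixed binary name, with distinct names for distinct symbols), $\phi$ being a Yes-instance if $\mathbb A\models\phi$ and a No-instance if $\mathbb B\not\models\phi$. The template is closed under complementation if for every symbol $R$ there is a symbol $\overline R$ of the same arity $n$ with $\overline R^{\mathbb A}=A^{n}\setminus R^{\mathbb A}$ and $\overline R^{\mathbb B}=B^{n}\setminus R^{\mathbb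 B}$. A promise problem is PSPACE-hard if for every language $X$ in PSPACE over a finite alphabet there is a function computable in logarithmic space that maps the words in $X$ to Yes-instances and the words not in $X$ to No-instances. **Proposition.** Let $\mathbb A,\mathbb B$ be structures in the same signature. 1. If $(\mathbb A,\mathbb B)$ is an $\{\exists,\forall,\wedge,\vee\}$-PMC template which is closed under complementation, then $\{\exists,\forall,\wedge,\vee\}\text{-}\mathrm{PMC}(\mathbb A,\mathbb B)$ is PSPACE-hard. 2. Consequently, if $\{\exists,\forall,\wedge,\vee\}\subsetneq\mathcal L\subseteq\{\exists,\forall,\wedge,\vee,=,\neq,\neg\}$ and $(\mathbb A,\mathbb B)$ is an $\mathcal L$-PMC template, then $\mathcal L\text{-}\mathrm{PMC}(\mathbb A,\mathbb B)$ is PSPACE-hard. In particular this holds for the extensions of $\{\exists,\forall,\wedge,\vee\}$ by $=$, by $\neq$ and by $\neg$. -/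

import Mathlib

namespace PMC

/-! ### Signatures and finite relational models -/

/-- A relational signature: a nonempty collection of symbols, each of arity at least one. -/
structure Signature where
  Symbol : Type*
  arity : Symbol → ℕ
  arity_pos : ∀ R, 1 ≤ arity R
  nonempty : Nonempty Symbol

/-- A relational structure: a finite universe with at least two elements, in which every symbol is
interpreted by a nonempty proper relation. -/
structure Model (S : Signature) where
  Carrier : Type*
  finite : Finite Carrier
  nontrivial : Nontrivial Carrier
  interp : (R : S.Symbol) → Set (Fin (S.arity R) → Carrier)
  interp_nonempty : ∀ R, (interp R).Nonempty
  interp_proper : ∀ R, interp R ≠ Set.univ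

/-! ### First-order formulas and their fragments -/

/-- First-order formulas over `S`; the variables are `x₀, x₁, x₂, …`. -/
inductive Formula (S : Signature) where
  | rel (R : S.Symbol) (v : Fin (S.arity R) → ℕ)
  | equal (i j : ℕ)
  | unequal (i j : ℕ)
  | neg (φ : Formula S)
  | conj (φ ψ : Formula S)
  | disj (φ ψ : Formula S)
  | ex (i : ℕ) (φ : Formula S)
  | all (i : ℕ) (φ : Formula S)

/-- The logical symbols `∃, ∀, ∧, ∨, =, ≠, ¬`. -/
inductive Op where
  | ex | all | conj | disj | equal | unequal | neg

/-- The fragment `{∃, ∀, ∧, ∨}`. -/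
def positiveOps : Set Op := {Op.ex, Op.all, Op.conj, Op.disj}

namespace Formula

variable {S : Signature}

/-- The logical symbols that occur in a formula. -/
def ops : Formula S → Set Op
  | rel _ _ => ∅
  | equal _ _ => {Op.equal}
  | unequal _ _ => {Op.unequal}
  | neg φ => insert Op.neg φ.ops
  | conj φ ψ => insert Op.conj (φ.ops ∪ ψ.ops)
  | disj φ ψ => insert Op.disj (φ.ops ∪ ψ.ops)
  | ex _ φ => insert Op.ex φ.ops
  | all _ φ => insert Op.all φ.ops

/-- The free variables of a formula. -/
def freeVars : Formula S → Set ℕ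
  | rel _ v => Set.range v
  | equal i j => {i, j}
  | unequal i j => {i, j}
  | neg φ => φ.freeVars
  | conj φ ψ => φ.freeVars ∪ ψ.freeVars
  | disj φ ψ => φ.freeVars ∪ ψ.freeVars
  | ex i φ => φ.freeVars \ {i}
  | all i φ => φ.freeVars \ {i}

/-- Tarski semantics under the evaluation `e` of the variables. -/
def Sat (A : Model S) : Formula S → (ℕ → A.Carrier) → Prop
  | rel R v, e => (fun k => e (v k)) ∈ A.interp R
  | equal i j, e => e i = e j
  | unequal i j, e => e i ≠ e j
  | neg φ, e => ¬ Sat A φ e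
  | conj φ ψ, e => Sat A φ e ∧ Sat A ψ e
  | disj φ ψ, e => Sat A φ e ∨ Sat A ψ e
  | ex i φ, e => ∃ a, Sat A φ (Function.update e i a)
  | all i φ, e => ∀ a, Sat A φ (Function.update e i a)

/-- An `L`-sentence: no free variables, and no logical symbols other than those in `L`. -/
def IsSentence (L : Set Op) (φ : Formula S) : Prop :=
  φ.freeVars = ∅ ∧ φ.ops ⊆ L

end Formula

/-- `A ⊨ φ`; only used for sentences, whose truth does not depend on the evaluation. -/
def Models {S : Signature} (A : Model S) (φ : Formula S) : Prop :=
  ∀ e : ℕ → A.Carrier, φ.Sat A e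

/-- `(A, B)` is an `L`-PMC template: every `L`-sentence true in `A` is true in `B`. -/
def IsTemplate {S : Signature} (L : Set Op) (A B : Model S) : Prop :=
  ∀ φ : Formula S, φ.IsSentence L → Models A φ → Models B φ

/-- Every symbol `R` has a symbol `R'` of the same arity that is interpreted, both in `A` and
in `B`, by the complement of the interpretation of `R`. -/
def ClosedUnderComplementation {S : Signature} (A B : Model S) : Prop :=
  ∀ R : S.Symbol, ∃ (R' : S.Symbol) (h : S.arity R' = S.arity R),
    (∀ t : Fin (S.arity R) → A.Carrier,
      (fun k => t (Fin.cast h k)) ∈ A.interp R' ↔ t ∉ A.interp R) ∧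
    (∀ t : Fin (S.arity R) → B.Carrier,
      (fun k => t (Fin.cast h k)) ∈ B.interp R' ↔ t ∉ B.interp R)

/-! ### Sentences as words -/

/-- The finite alphabet in which formulas are written. -/
inductive Token where
  | ex | all | conj | disj | equal | unequal | neg
  | rel | bit (b : Bool)
  | var | tick

/-- The variable `xᵢ` is written as `var` followed by `i` ticks. -/
def encodeVar (i : ℕ) : List Token := Token.var :: List.replicate i Token.tick

/-- A formula in prefix (Polish) notation. A relation symbol `R` is written as `rel` followed by
its name `code R`. -/
def encode {S : Signature} (code : S.Symbol → List Bool) : Formula S → List Token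
  | .rel R v => Token.rel :: ((code R).map Token.bit ++ (List.ofFn fun k => encodeVar (v k)).flatten)
  | .equal i j => Token.equal :: (encodeVar i ++ encodeVar j)
  | .unequal i j => Token.unequal :: (encodeVar i ++ encodeVar j)
  | .neg φ => Token.neg :: encode code φ
  | .conj φ ψ => Token.conj :: (encode code φ ++ encode code ψ)
  | .disj φ ψ => Token.disj :: (encode code φ ++ encode code ψ)
  | .ex i φ => Token.ex :: (encodeVar i ++ encode code φ)
  | .all i φ => Token.all :: (encodeVar i ++ encode code φ)

/-- A promise problem over the alphabet `β`: a set of Yes-instances and a set of No-instances. -/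
structure PromiseProblem (β : Type*) where
  yes : Set (List β)
  no : Set (List β)

/-- The `L`-Promise Model Checking Problem over `(A, B)`, with relation symbols named by `code`. -/
def promiseMC {S : Signature} (code : S.Symbol → List Bool) (L : Set Op) (A B : Model S) :
    PromiseProblem Token where
  yes := {w | ∃ φ : Formula S, φ.IsSentence L ∧ Models A φ ∧ w = encode code φ}
  no := {w | ∃ φ : Formula S, φ.IsSentence L ∧ ¬ Models B φ ∧ w = encode code φ}

/-! ### Polynomial space -/

/-- Head movements. -/
inductive Move where
  | left | stay | right

/-- The displacement of a head. -/
def Move.toInt : Move → ℤ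
  | .left => -1
  | .stay => 0
  | .right => 1

/-- A deterministic single-tape Turing machine with input alphabet `α`. Tape symbols are the
blank `none`, the input symbols and the additional symbols in `Γ`. The machine halts when
`δ` gives no instruction, and then accepts iff its state is accepting. -/
structure TM (α : Type) where
  Q : Type
  finite_Q : Finite Q
  Γ : Type
  finite_Γ : Finite Γ
  start : Q
  accepting : Set Q
  δ : Q → Option (α ⊕ Γ) → Option (Q × Option (α ⊕ Γ) × Move)

namespace TM

variable {α : Type} (M : TM α)

/-- A configuration; the tape is infinite in both directions. -/
structure Cfg where
  state : M.Q
  head : ℤ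
  tape : ℤ → Option (α ⊕ M.Γ)

/-- The input `w` stands on the cells `0, …, |w| - 1`, the other cells are blank. -/
def init (w : List α) : M.Cfg where
  state := M.start
  head := 0
  tape := fun z => if 0 ≤ z then (w[z.toNat]?).map Sum.inl else none

/-- One step of the computation; `none` if the machine has halted. -/
def step (c : M.Cfg) : Option M.Cfg :=
  (M.δ c.state (c.tape c.head)).map fun a =>
    { state := a.1
      head := c.head + a.2.2.toInt
      tape := Function.update c.tape c.head a.2.1 }

/-- Reachability in finitely many steps. -/
def Reaches : M.Cfg → M.Cfg → Prop :=
  Relation.ReflTransGen fun c d => M.step c = some d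

/-- `M` decides `X` in space `O(s)`: on every input `w` it halts, its head stays within the cells
`-s(|w|), …, s(|w|)`, and it accepts iff `w ∈ X`. -/
def DecidesInSpace (X : Set (List α)) (s : ℕ → ℕ) : Prop :=
  ∀ w : List α,
    (∀ c, M.Reaches (M.init w) c → c.head.natAbs ≤ s w.length) ∧
    ∃ c, M.Reaches (M.init w) c ∧ M.step c = none ∧ (c.state ∈ M.accepting ↔ w ∈ X)

end TM

/-- The class PSPACE. -/
def InPSPACE {α : Type} (X : Set (List α)) : Prop :=
  ∃ (M : TM α) (p : Polynomial ℕ), M.DecidesInSpace X fun n => p.eval n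

/-! ### Logarithmic space reductions -/

/-- Content of a cell of the read-only input tape: an input symbol or an end marker. -/
inductive InputCell (α : Type*) where
  | leftEnd
  | sym (a : α)
  | rightEnd

/-- A deterministic Turing machine with a two-way read-only input tape, `k` work tapes with
alphabet `Option Γ` (blank `none`) and a write-only output tape. An instruction consists
of the new state, the movement of the input head, what is written by each work head and how it
moves, and the word that is appended to the output. The machine halts when `δ` gives no
instruction. -/
structure Transducer (α β : Type) where
  Q : Type
  finite_Q : Finite Q
  Γ : Type
  finite_Γ : Finite Γ
  k : ℕ
  start : Q
  δ : Q → InputCell α → (Fin k → Option Γ) →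
    Option (Q × Move × (Fin k → Option Γ × Move) × List β)

namespace Transducer

variable {α β : Type} (T : Transducer α β)

structure Cfg where
  state : T.Q
  inputHead : ℕ
  head : Fin T.k → ℤ
  tape : Fin T.k → ℤ → Option T.Γ
  output : List β

/-- The input tape: left end marker on cell `0`, the word `w` on the cells `1, …, |w|`, right end
marker on cell `|w| + 1`. -/
def inputTape (w : List α) : ℕ → InputCell α
  | 0 => .leftEnd
  | i + 1 => (w[i]?).elim .rightEnd .sym

/-- Movement of the input head, which cannot leave the cells `0, …, n + 1`. -/
def moveInput (n h : ℕ) : Move → ℕ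
  | .left => h - 1
  | .stay => h
  | .right => min (h + 1) (n + 1)

def init : T.Cfg where
  state := T.start
  inputHead := 0
  head := fun _ => 0
  tape := fun _ _ => none
  output := []

/-- One step of the computation on input `w`; `none` if the machine has halted. -/
def step (w : List α) (c : T.Cfg) : Option T.Cfg :=
  (T.δ c.state (inputTape w c.inputHead) (fun i => c.tape i (c.head i))).map fun a =>
    { state := a.1
      inputHead := moveInput w.length c.inputHead a.2.1
      head := fun i => c.head i + (a.2.2.1 i).2.toInt
      tape := fun i => Function.update (c.tape i) (c.head i) (a.2.2.1 i).1
      output := c.output ++ a.2.2.2 }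

/-- Reachability in finitely many steps on input `w`. -/
def Reaches (w : List α) : T.Cfg → T.Cfg → Prop :=
  Relation.ReflTransGen fun c d => T.step w c = some d

/-- `T` computes `f` in space `O(s)`: on every input `w` it halts with output `f w`, and its work
heads stay within the cells `-s(|w|), …, s(|w|)`. -/
def ComputesInSpace (f : List α → List β) (s : ℕ → ℕ) : Prop :=
  ∀ w : List α,
    (∀ c, T.Reaches w T.init c → ∀ i, (c.head i).natAbs ≤ s w.length) ∧
    ∃ c, T.Reaches w T.init c ∧ T.step w c = none ∧ c.output = f w

end Transducer

/-- `f` is computable in logarithmic space. -/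
def LogSpaceComputable {α β : Type} (f : List α → List β) : Prop :=
  ∃ (T : Transducer α β) (C : ℕ), T.ComputesInSpace f fun n => C * (Nat.log 2 n + 1)

/-- A promise problem is PSPACE-hard if every language in PSPACE, over any finite alphabet, has a
logarithmic space many-one reduction to it: members are mapped to Yes-instances and
non-members to No-instances. -/
def PSPACEHard {β : Type} (P : PromiseProblem β) : Prop :=
  ∀ (α : Type) [Finite α] (X : Set (List α)), InPSPACE X →
    ∃ f : List α → List β, LogSpaceComputable f ∧
      (∀ w ∈ X, f w ∈ P.yes) ∧ (∀ w ∉ X, f w ∈ P.no)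

end PMC

/-!
Iterating the one-step relation of a Turing machine in polynomial space `2 ^ n` times by repeated
halving gives a quantified Boolean formula of polynomial length: the midpoint of each level is
existential, a universal bit selects one of the two halves, and both share the recursive call. For
this the machine becomes a cyclic cellular automaton, whose step relation is the same at all cells.

A closed quantified Boolean formula becomes a first-order sentence once a formula defines a
nontrivial equivalence relation. Two universally chosen inequivalent points stand for the truth
values, and Boolean variables become elements. What about the elements that are equivalent to
neither point? Name some elements existentially and take the conjunction over all assignments of
truth values to the names: an element counts as `b` if it is equivalent to the point for `b` or to
a name to which `b` is assigned. If everything is named, every element counts as some truth value,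
and as an element that counts as both only makes more literals true, a true formula stays true.
Conversely, under the assignment that respects equivalence to the point for `true` no element counts
as both, so a sentence that holds comes from a true formula.

For `=` and `≠` the equivalence relation is equality, with the dual translation for `≠`. For `¬` and
for complements it is indiscernibility in the positions of a relation `R`, which is nontrivial
because `R` is neither empty nor full: otherwise the coordinates of a tuple of `R` could be changed
one at a time into any others without leaving `R`.

The sentence is a fixed pattern of nested loops over polynomially bounded counters. A machine with a
logarithmic work tape keeps the `k`-th digits of all counters in its `k`-th cell and updates them
in sweeps.
-/

namespace PMC

/-! ### Sweeping machines -/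

/-- A finite control that repeatedly sweeps from left to right over a list of columns. A sweep
rewrites the columns and possibly appends one; after it the machine reads the input cell, moves the
input head, emits a word, and continues in the next state or, on `none`, exits. -/
structure SweepMachine (α β Col : Type) where
  Q : Type
  finite_Q : Finite Q
  start : Q
  scan : Q → Col → Q × Col
  append : Q → Option Col
  next : Q → InputCell α → Option Q × Move × List β

namespace SweepMachine

open Transducer (inputTape moveInput)

variable {α β Col : Type}

/-- The state and the columns after one sweep. -/
def sweep (F : SweepMachine α β Col) : F.Q → List Col → F.Q × List Col
  | q, [] => (q, (F.append q).toList)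
  | q, c :: cs =>
    let r := F.sweep (F.scan q c).1 cs
    (r.1, (F.scan q c).2 :: r.2)

/-- `F.Runs w q h cs h' cs' o`: on input `w`, started in state `q` with input head `h` and columns
`cs`, the machine exits with input head `h'` and columns `cs'`, having emitted `o`. -/
inductive Runs (F : SweepMachine α β Col) (w : List α) :
    F.Q → ℕ → List Col → ℕ → List Col → List β → Prop
  | exit {q : F.Q} {h : ℕ} {cs : List Col} {m : Move} {o : List β} :
      F.next (F.sweep q cs).1 (inputTape w h) = (none, m, o) →
      Runs F w q h cs (moveInput w.length h m) (F.sweep q cs).2 o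
  | step {q q' : F.Q} {h h' : ℕ} {cs cs' : List Col} {m : Move} {o o' : List β} :
      F.next (F.sweep q cs).1 (inputTape w h) = (some q', m, o) →
      Runs F w q' (moveInput w.length h m) (F.sweep q cs).2 h' cs' o' →
      Runs F w q h cs h' cs' (o ++ o')

theorem length_le_length_sweep (F : SweepMachine α β Col) (q : F.Q) (cs : List Col) :
    cs.length ≤ (F.sweep q cs).2.length := by
  induction cs generalizing q with
  | nil => simp [sweep]
  | cons c cs ih => simpa [sweep] using ih _

theorem Runs.length_le {F : SweepMachine α β Col} {w : List α} {q : F.Q} {h h' : ℕ}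
    {cs cs' : List Col} {o : List β} (r : F.Runs w q h cs h' cs' o) : cs.length ≤ cs'.length := by
  induction r with
  | exit => exact F.length_le_length_sweep _ _
  | step _ _ ih => exact (F.length_le_length_sweep _ _).trans ih

end SweepMachine

/-! ### Simulating a sweeping machine in small space -/

/-- The bi-infinite tape on which a list is written from cell `0` on. -/
def tapeOf {Col : Type} (cs : List Col) : ℤ → Option Col :=
  fun z => if 0 ≤ z then cs[z.toNat]? else none

section tapeOf

variable {Col : Type}

theorem tapeOf_natCast (cs : List Col) (n : ℕ) : tapeOf cs n = cs[n]? := by simp [tapeOf]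

theorem tapeOf_of_neg (cs : List Col) {z : ℤ} (hz : z < 0) : tapeOf cs z = none := by
  simp [tapeOf, not_le.2 hz]

theorem tapeOf_eq_update {cs cs' : List Col} {n : ℕ} {o : Option Col} (hn : cs'[n]? = o)
    (h : ∀ k ≠ n, cs'[k]? = cs[k]?) : Function.update (tapeOf cs) (n : ℤ) o = tapeOf cs' := by
  subst hn
  funext z
  rcases lt_or_ge z 0 with hz | hz
  · rw [Function.update_of_ne (by lia), tapeOf_of_neg _ hz, tapeOf_of_neg _ hz]
  · lift z to ℕ using hz
    rcases eq_or_ne z n with rfl | hne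
    · rw [Function.update_self, tapeOf_natCast]
    · rw [Function.update_of_ne (by exact_mod_cast hne), tapeOf_natCast, tapeOf_natCast, h z hne]

theorem update_tapeOf_middle (pre suf : List Col) (c c' : Col) :
    Function.update (tapeOf (pre ++ c :: suf)) (pre.length : ℤ) (some c') =
      tapeOf (pre ++ c' :: suf) :=
  tapeOf_eq_update (by simp) fun k hk => by grind

theorem update_tapeOf_length (cs : List Col) (o : Option Col) :
    Function.update (tapeOf cs) (cs.length : ℤ) o = tapeOf (cs ++ o.toList) :=
  tapeOf_eq_update (by cases o <;> simp) fun k hk => by cases o <;> grind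

end tapeOf

namespace Transducer

variable {α β : Type} {T : Transducer α β} {w : List α} {s : ℕ} {c d x : T.Cfg}

/-- A computation step from a configuration with all work heads within distance `s` of cell `0`. -/
def BoundedStep (T : Transducer α β) (w : List α) (s : ℕ) (c d : T.Cfg) : Prop :=
  T.step w c = some d ∧ ∀ i, (c.head i).natAbs ≤ s

/-- Reachability by bounded steps. -/
abbrev BoundedReaches (T : Transducer α β) (w : List α) (s : ℕ) : T.Cfg → T.Cfg → Prop :=
  Relation.ReflTransGen (T.BoundedStep w s)

theorem BoundedReaches.reaches (h : T.BoundedReaches w s c d) : T.Reaches w c d :=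
  Relation.ReflTransGen.mono (p := fun c d => T.step w c = some d) (fun _ _ h => h.1) _ _ h

theorem BoundedReaches.natAbs_head_le_of_halted (h : T.BoundedReaches w s c d)
    (halted : T.step w d = none) (hs : ∀ i, (d.head i).natAbs ≤ s) (hx : T.Reaches w c x) :
    ∀ i, (x.head i).natAbs ≤ s := by
  induction h using Relation.ReflTransGen.head_induction_on with
  | refl =>
    rcases Relation.ReflTransGen.cases_head hx with rfl | ⟨y, hy, -⟩
    · exact hs
    · simp [halted] at hy
  | head h _ ih =>
    rcases Relation.ReflTransGen.cases_head hx with rfl | ⟨y, hy, hyx⟩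
    · exact h.2
    · obtain rfl := Option.some.inj (h.1.symm.trans hy)
      exact ih hyx

end Transducer

namespace SweepMachine

open Transducer (inputTape moveInput)

/-- The states of the transducer that simulates a sweeping machine with states `Q`: it sweeps to
the right, returns to the left, and has one halting state. -/
inductive Phase (Q : Type) where
  | sweep (q : Q)
  | return (q : Q)
  | halt

instance {Q : Type} [Finite Q] : Finite (Phase Q) :=
  Finite.of_injective
    (fun p : Phase Q => match p with
      | .sweep q => (some (.inl q) : Option (Q ⊕ Q))
      | .return q => some (.inr q)
      | .halt => none)
    (by rintro (_ | _ | _) (_ | _ | _) h <;> simp_all)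

/-- The phase that follows the end of a sweep. -/
def Phase.ofNext {Q : Type} : Option Q → Phase Q
  | some q => .sweep q
  | none => .halt

variable {α β Col : Type}

/-- The instructions of the transducer that simulates a sweeping machine. -/
def instr (F : SweepMachine α β Col) : Phase F.Q → InputCell α → (Fin 1 → Option Col) →
    Option (Phase F.Q × Move × (Fin 1 → Option Col × Move) × List β)
  | .sweep q, _, t => match t 0 with
    | some c => some (.sweep (F.scan q c).1, .stay, fun _ => (some (F.scan q c).2, .right), [])
    | none => some (.return q, .stay, fun _ => (F.append q, .left), [])
  | .return q, x, t => match t 0 with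
    | some c => some (.return q, .stay, fun _ => (some c, .left), [])
    | none =>
      let a := F.next q x
      some (.ofNext a.1, a.2.1, fun _ => (none, .right), a.2.2)
  | .halt, _, _ => none

variable [Finite Col]

/-- The transducer whose only work tape holds the columns of a sweeping machine. -/
def toTransducer (F : SweepMachine α β Col) : Transducer α β where
  Q := Phase F.Q
  finite_Q := have := F.finite_Q; inferInstance
  Γ := Col
  finite_Γ := inferInstance
  k := 1
  start := .sweep F.start
  δ := F.instr

/-- A configuration of the simulating transducer. -/
def cfg (F : SweepMachine α β Col) (p : Phase F.Q) (h : ℕ) (z : ℤ) (cs : List Col) (o : List β) :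
    F.toTransducer.Cfg where
  state := p
  inputHead := h
  head := fun _ => z
  tape := fun _ => tapeOf cs
  output := o

variable (F : SweepMachine α β Col) (w : List α) {s : ℕ} (h : ℕ) (q : F.Q) (o : List β)

theorem step_sweep_middle (pre suf : List Col) (c : Col) :
    F.toTransducer.step w (F.cfg (.sweep q) h pre.length (pre ++ c :: suf) o) =
      some (F.cfg (.sweep (F.scan q c).1) h (pre.length + 1) (pre ++ (F.scan q c).2 :: suf) o) := by
  simp [Transducer.step, cfg, toTransducer, instr, tapeOf_natCast, update_tapeOf_middle,
    moveInput, Move.toInt]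

theorem step_sweep_end (cs : List Col) :
    F.toTransducer.step w (F.cfg (.sweep q) h cs.length cs o) =
      some (F.cfg (.return q) h (cs.length - 1) (cs ++ (F.append q).toList) o) := by
  simp [Transducer.step, cfg, toTransducer, instr, tapeOf_natCast, update_tapeOf_length,
    moveInput, Move.toInt, sub_eq_add_neg]

theorem step_return_middle {cs : List Col} {k : ℕ} (hk : k < cs.length) :
    F.toTransducer.step w (F.cfg (.return q) h k cs o) =
      some (F.cfg (.return q) h (k - 1) cs o) := by
  have hcell : tapeOf cs (k : ℤ) = some cs[k] := by simp [tapeOf_natCast, hk]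
  have hwrite : Function.update (tapeOf cs) (k : ℤ) (some cs[k]) = tapeOf cs := by
    rw [← hcell, Function.update_eq_self]
  simp [Transducer.step, cfg, toTransducer, instr, hcell, hwrite, moveInput, Move.toInt,
    sub_eq_add_neg]

theorem step_return_end (cs : List Col) :
    F.toTransducer.step w (F.cfg (.return q) h (-1) cs o) =
      some (F.cfg (.ofNext (F.next q (inputTape w h)).1)
        (moveInput w.length h (F.next q (inputTape w h)).2.1) 0 cs
        (o ++ (F.next q (inputTape w h)).2.2)) := by
  have hcell : tapeOf cs (-1) = none := tapeOf_of_neg _ (by norm_num)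
  have hwrite : Function.update (tapeOf cs) (-1) none = tapeOf cs := by
    rw [← hcell, Function.update_eq_self]
  simp [Transducer.step, cfg, toTransducer, instr, hcell, hwrite, Move.toInt]

theorem boundedReaches_sweep (suf pre : List Col) (hs : pre.length + suf.length ≤ s) :
    F.toTransducer.BoundedReaches w s (F.cfg (.sweep q) h pre.length (pre ++ suf) o)
      (F.cfg (.return (F.sweep q suf).1) h ((pre ++ suf).length - 1)
        (pre ++ (F.sweep q suf).2) o) := by
  induction suf generalizing pre q with
  | nil =>
    rw [List.append_nil]
    exact .single ⟨F.step_sweep_end w h q o pre, fun _ => by simpa [cfg] using hs⟩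
  | cons c suf ih =>
    have hle : pre.length ≤ s := (Nat.le_add_right _ _).trans hs
    refine .head ⟨F.step_sweep_middle w h q o pre suf c, fun _ => by simpa [cfg] using hle⟩ ?_
    simpa [sweep, add_comm, add_left_comm] using
      ih (F.scan q c).1 (pre ++ [(F.scan q c).2]) (by simpa [add_comm, add_left_comm] using hs)

theorem boundedReaches_return {cs : List Col} {k : ℕ} (hk : k ≤ cs.length) (hs : cs.length ≤ s) :
    F.toTransducer.BoundedReaches w s (F.cfg (.return q) h (k - 1) cs o)
      (F.cfg (.return q) h (-1) cs o) := by
  induction k with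
  | zero => simpa using Relation.ReflTransGen.refl
  | succ k ih =>
    rw [Nat.cast_succ, add_sub_cancel_right]
    exact .head ⟨F.step_return_middle w h q o hk, fun _ => by simp only [cfg]; lia⟩ (ih (by lia))

theorem boundedReaches_round {cs : List Col} (hpos : 1 ≤ s)
    (hs : (F.sweep q cs).2.length ≤ s) {next : Option F.Q} {m : Move} {l : List β}
    (e : F.next (F.sweep q cs).1 (inputTape w h) = (next, m, l)) :
    F.toTransducer.BoundedReaches w s (F.cfg (.sweep q) h 0 cs o)
      (F.cfg (.ofNext next) (moveInput w.length h m) 0 (F.sweep q cs).2 (o ++ l)) := by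
  have hle := F.length_le_length_sweep q cs
  have sweeping := F.boundedReaches_sweep w h q o cs [] (s := s) (by simpa using hle.trans hs)
  have returning := F.boundedReaches_return w h (F.sweep q cs).1 o hle hs
  have turning := F.step_return_end w h (F.sweep q cs).1 o (F.sweep q cs).2
  rw [e] at turning
  exact (sweeping.trans returning).tail ⟨turning, fun _ => by simpa [cfg] using hpos⟩

variable {F w h q} in
theorem Runs.boundedReaches {cs cs' : List Col} {h' : ℕ} {l : List β}
    (r : F.Runs w q h cs h' cs' l) (hpos : 1 ≤ s) (hs : cs'.length ≤ s) :
    F.toTransducer.BoundedReaches w s (F.cfg (.sweep q) h 0 cs o)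
      (F.cfg .halt h' 0 cs' (o ++ l)) := by
  induction r generalizing o with
  | exit e => exact F.boundedReaches_round w _ _ o hpos hs e
  | step e r ih =>
    rw [← List.append_assoc]
    exact (F.boundedReaches_round w _ _ o hpos (r.length_le.trans hs) e).trans (ih _ hs)

theorem logSpaceComputable {f : List α → List β} (C : ℕ)
    (hf : ∀ w, ∃ h' cs', cs'.length ≤ C * (Nat.log 2 w.length + 1) ∧
      F.Runs w F.start 0 [] h' cs' (f w)) : LogSpaceComputable f := by
  refine ⟨F.toTransducer, C + 1, fun w => ?_⟩
  obtain ⟨h', cs', hl, r⟩ := hf w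
  have hpos : 1 ≤ (C + 1) * (Nat.log 2 w.length + 1) := Nat.mul_pos (by lia) (by lia)
  have reach := r.boundedReaches [] hpos (hl.trans (Nat.mul_le_mul_right _ (by lia)))
  have hinit : F.cfg (.sweep F.start) 0 0 [] [] = F.toTransducer.init := by
    have blank : tapeOf ([] : List Col) = fun _ => none := by funext z; simp [tapeOf]
    simp [cfg, Transducer.init, toTransducer, blank]
  have halted : F.toTransducer.step w (F.cfg .halt h' 0 cs' ([] ++ f w)) = none := by
    simp [Transducer.step, cfg, toTransducer, instr]
  rw [hinit] at reach
  exact ⟨fun c hc => reach.natAbs_head_le_of_halted halted (by simp [cfg]) hc,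
    _, reach.reaches, halted, by simp [cfg]⟩

end SweepMachine

/-! ### Combining sweeping machines -/

instance {α : Type} [Finite α] : Finite (InputCell α) :=
  Finite.of_injective
    (fun x : InputCell α => match x with
      | .leftEnd => (none : Option (Option α))
      | .sym a => some (some a)
      | .rightEnd => some none)
    (by rintro (_ | _ | _) (_ | _ | _) h <;> simp_all)

namespace SweepMachine

open Transducer (inputTape moveInput)

variable {α β Col : Type}

/-- `F` is a part of `G` via the embedding `i` of its states; where `F` exits, `G` continues in the
state `exit`, or exits too if `exit` is `none`. -/
structure IsPart (F G : SweepMachine α β Col) (i : F.Q → G.Q) (exit : Option G.Q) : Prop where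
  scan : ∀ q c, G.scan (i q) c = (i (F.scan q c).1, (F.scan q c).2)
  append : ∀ q, G.append (i q) = F.append q
  next : ∀ q x, G.next (i q) x = ((F.next q x).1.elim exit (some ∘ i), (F.next q x).2)

section IsPart

variable {F G : SweepMachine α β Col} {i : F.Q → G.Q} {w : List α} {q : F.Q}
  {h h' h'' : ℕ} {cs cs' cs'' : List Col} {o o' : List β}

theorem IsPart.sweep {exit : Option G.Q} (hi : F.IsPart G i exit) (q : F.Q) (cs : List Col) :
    G.sweep (i q) cs = (i (F.sweep q cs).1, (F.sweep q cs).2) := by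
  induction cs generalizing q with
  | nil => simp [SweepMachine.sweep, hi.append]
  | cons c cs ih => simp [SweepMachine.sweep, hi.scan, ih]

theorem IsPart.next_sweep {exit : Option G.Q} (hi : F.IsPart G i exit) {x : InputCell α}
    {next : Option F.Q} {m : Move} (e : F.next (F.sweep q cs).1 x = (next, m, o)) :
    G.next (G.sweep (i q) cs).1 x = (next.elim exit (some ∘ i), m, o) := by
  rw [hi.sweep, hi.next, e]

theorem Runs.ofPart (r : F.Runs w q h cs h' cs' o) (hi : F.IsPart G i none) :
    G.Runs w (i q) h cs h' cs' o := by
  induction r with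
  | @exit q h cs m o e =>
    rw [show (F.sweep q cs).2 = (G.sweep (i q) cs).2 by rw [hi.sweep]]
    exact .exit (hi.next_sweep e)
  | step e _ ih => exact .step (hi.next_sweep e) (by rw [hi.sweep]; exact ih)

theorem Runs.append {q₀ : G.Q} (r : F.Runs w q h cs h' cs' o) (hi : F.IsPart G i (some q₀))
    (r' : G.Runs w q₀ h' cs' h'' cs'' o') : G.Runs w (i q) h cs h'' cs'' (o ++ o') := by
  induction r with
  | exit e => exact .step (hi.next_sweep e) (by rw [hi.sweep]; exact r')
  | step e _ ih =>
    rw [List.append_assoc]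
    exact .step (hi.next_sweep e) (by rw [hi.sweep]; exact ih r')

end IsPart

theorem sweep_of_readOnly {F : SweepMachine α β Col} {S : Type} (i : S → F.Q) (δ : S → Col → S)
    (hs : ∀ s c, F.scan (i s) c = (i (δ s c), c)) (ha : ∀ s, F.append (i s) = none) (s : S)
    (cs : List Col) : F.sweep (i s) cs = (i (cs.foldl δ s), cs) := by
  induction cs generalizing s with
  | nil => simp [sweep, ha]
  | cons c cs ih => simp [sweep, hs, ih]

/-- First `F`, then `G`. -/
def seq (F G : SweepMachine α β Col) : SweepMachine α β Col where
  Q := F.Q ⊕ G.Q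
  finite_Q := have := F.finite_Q; have := G.finite_Q; inferInstance
  start := .inl F.start
  scan
    | .inl q, c => (.inl (F.scan q c).1, (F.scan q c).2)
    | .inr q, c => (.inr (G.scan q c).1, (G.scan q c).2)
  append
    | .inl q => F.append q
    | .inr q => G.append q
  next
    | .inl q, x => ((F.next q x).1.elim (some (.inr G.start)) (some ∘ Sum.inl), (F.next q x).2)
    | .inr q, x => ((G.next q x).1.elim none (some ∘ Sum.inr), (G.next q x).2)

theorem Runs.seq {F G : SweepMachine α β Col} {w : List α} {h h' h'' : ℕ}
    {cs cs' cs'' : List Col} {o o' : List β} (r : F.Runs w F.start h cs h' cs' o)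
    (r' : G.Runs w G.start h' cs' h'' cs'' o') :
    (F.seq G).Runs w (F.seq G).start h cs h'' cs'' (o ++ o') :=
  r.append (G := F.seq G) (i := .inl) ⟨fun _ _ => rfl, fun _ => rfl, fun _ _ => rfl⟩
    (r'.ofPart (G := F.seq G) (i := .inr) ⟨fun _ _ => rfl, fun _ => rfl, fun _ _ => rfl⟩)

/-- The machine without memory that never changes the columns. -/
def reader (next : InputCell α → Option Unit × Move × List β) : SweepMachine α β Col where
  Q := Unit
  finite_Q := inferInstance
  start := ()
  scan _ c := ((), c)
  append _ := none
  next _ := next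

theorem sweep_reader (next : InputCell α → Option Unit × Move × List β) (cs : List Col) :
    (reader next).sweep () cs = ((), cs) :=
  sweep_of_readOnly (F := reader next) id (fun _ _ => ()) (fun _ _ => rfl) (fun _ => rfl) () cs

section reader

variable {next : InputCell α → Option Unit × Move × List β} {w : List α} {h h' : ℕ} {m : Move}
  {o o' : List β} {cs cs' : List Col}

theorem runs_reader_exit (e : next (inputTape w h) = (none, m, o)) :
    (reader next).Runs w () h cs (moveInput w.length h m) cs o := by
  simpa only [sweep_reader] using Runs.exit (F := reader next) (q := ()) (cs := cs) e

theorem runs_reader_step (e : next (inputTape w h) = (some (), m, o))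
    (r : (reader next).Runs w () (moveInput w.length h m) cs h' cs' o') :
    (reader next).Runs w () h cs h' cs' (o ++ o') :=
  .step (F := reader next) e (by rwa [sweep_reader])

end reader

/-- Emits a word and moves the input head. -/
def emit (l : List β) (m : Move) : SweepMachine α β Col := reader fun _ => (none, m, l)

theorem runs_emit (l : List β) (m : Move) (w : List α) (h : ℕ) (cs : List Col) :
    (emit l m).Runs w (emit l m : SweepMachine α β Col).start h cs (moveInput w.length h m) cs l :=
  runs_reader_exit rfl

/-- Moves the input head to the left end. -/
def rewindInput : SweepMachine α β Col :=
  reader fun x => match x with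
    | .leftEnd => (none, .stay, [])
    | _ => (some (), .left, [])

theorem runs_rewindInput (w : List α) (h : ℕ) (cs : List Col) :
    rewindInput.Runs w (rewindInput : SweepMachine α β Col).start h cs 0 cs [] := by
  induction h with
  | zero => exact runs_reader_exit (m := .stay) rfl
  | succ h ih =>
    refine runs_reader_step (m := .left) (o := []) ?_ ih
    cases hx : w[h]? <;> simp [inputTape, hx]

/-- Reads the columns with a finite automaton and then the input cell, and continues with the
machine selected by the outcome. -/
def branch {S J : Type} [Finite S] [Finite J] (s₀ : S) (δ : S → Col → S)
    (out : S → InputCell α → J) (F : J → SweepMachine α β Col) : SweepMachine α β Col where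
  Q := S ⊕ Σ j, (F j).Q
  finite_Q := have := fun j => (F j).finite_Q; inferInstance
  start := .inl s₀
  scan
    | .inl s, c => (.inl (δ s c), c)
    | .inr ⟨j, q⟩, c => (.inr ⟨j, ((F j).scan q c).1⟩, ((F j).scan q c).2)
  append
    | .inl _ => none
    | .inr ⟨j, q⟩ => (F j).append q
  next
    | .inl s, x => (some (.inr ⟨out s x, (F (out s x)).start⟩), .stay, [])
    | .inr ⟨j, q⟩, x => (((F j).next q x).1.elim none (some ∘ fun q => .inr ⟨j, q⟩),
        ((F j).next q x).2)

theorem Runs.branch {S J : Type} [Finite S] [Finite J] {s₀ : S} {δ : S → Col → S}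
    {out : S → InputCell α → J} {F : J → SweepMachine α β Col} {w : List α} {h h' : ℕ}
    {cs cs' : List Col} {o : List β} {j : J} (hj : out (cs.foldl δ s₀) (inputTape w h) = j)
    (r : (F j).Runs w (F j).start h cs h' cs' o) :
    (branch s₀ δ out F).Runs w (branch s₀ δ out F).start h cs h' cs' o := by
  subst hj
  have hsweep : (SweepMachine.branch s₀ δ out F).sweep (.inl s₀) cs = (.inl (cs.foldl δ s₀), cs) :=
    sweep_of_readOnly (F := .branch s₀ δ out F) Sum.inl δ (fun _ _ => rfl) (fun _ => rfl) s₀ cs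
  refine .step (F := .branch s₀ δ out F) (q := Sum.inl s₀) (m := .stay) (o := [])
    (by rw [hsweep]; rfl) ?_
  rw [hsweep]
  exact r.ofPart (G := .branch s₀ δ out F) (i := fun q => Sum.inr ⟨_, q⟩)
    ⟨fun _ _ => rfl, fun _ => rfl, fun _ _ => rfl⟩

end SweepMachine

/-! ### Tracks of columns as counters -/

/-- The columns of the `L` lowest digits in base `b` of the numbers in `σ`, least significant digit
first. -/
def columns {K : ℕ} (b : ℕ) [NeZero b] : ℕ → (Fin K → ℕ) → List (Fin K → Fin b)
  | 0, _ => []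
  | L + 1, σ => (fun v => Fin.ofNat b (σ v)) :: columns b L (fun v => σ v / b)

section columns

variable {K b : ℕ}

theorem div_lt_pow_of_lt_pow_succ {x L : ℕ} (h : x < b ^ (L + 1)) : x / b < b ^ L :=
  Nat.div_lt_of_lt_mul (pow_succ' b L ▸ h)

variable [NeZero b]

theorem length_columns (L : ℕ) (σ : Fin K → ℕ) : (columns b L σ).length = L := by
  induction L generalizing σ with
  | zero => rfl
  | succ L ih => simp [columns, ih]

theorem columns_congr {L : ℕ} {σ τ : Fin K → ℕ} (h : ∀ v, σ v % b ^ L = τ v % b ^ L) :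
    columns b L σ = columns b L τ := by
  induction L generalizing σ τ with
  | zero => rfl
  | succ L ih =>
    refine congrArg₂ List.cons (funext fun v => Fin.ext ?_) (ih fun v => ?_)
    · simpa [pow_succ, Nat.mod_mul_left_mod] using congrArg (· % b) (h v)
    · simpa [pow_succ', Nat.mod_mul_right_div_self] using congrArg (· / b) (h v)

theorem add_carry_div (x : ℕ) (s : Bool) :
    (x + s.toNat) / b = x / b + (decide (b ≤ x % b + s.toNat)).toNat := by
  have hb : 0 < b := NeZero.pos b
  have hs : s.toNat ≤ b := (Bool.toNat_le s).trans hb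
  have hmod := Nat.mod_lt x hb
  conv_lhs => rw [← Nat.div_add_mod x b, add_assoc, Nat.mul_add_div hb]
  by_cases h : b ≤ x % b + s.toNat
  · simp only [h, decide_true, Bool.toNat_true, Nat.div_eq_of_lt_le (k := 1) (n := b)
      (m := x % b + s.toNat) (by lia) (by lia)]
  · simp only [h, decide_false, Bool.toNat_false, Nat.div_eq_of_lt (not_le.1 h)]

end columns

namespace SweepMachine

open Transducer (inputTape moveInput)

variable {α β : Type} {K b : ℕ} [NeZero b]

/-- Repeats `F`, incrementing the counter on track `m` after each repetition and moving the input
head by `mv` between repetitions, until the counter overflows. The state of an increment is the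
carry. -/
def loop (F : SweepMachine α β (Fin K → Fin b)) (m : Fin K) (mv : Move) :
    SweepMachine α β (Fin K → Fin b) where
  Q := F.Q ⊕ Bool
  finite_Q := have := F.finite_Q; inferInstance
  start := .inl F.start
  scan
    | .inl q, c => (.inl (F.scan q c).1, (F.scan q c).2)
    | .inr s, c => (.inr (decide (b ≤ c m + s.toNat)),
        Function.update c m (Fin.ofNat b (c m + s.toNat)))
  append
    | .inl q => F.append q
    | .inr _ => none
  next
    | .inl q, x => ((F.next q x).1.elim (some (.inr true)) (some ∘ Sum.inl), (F.next q x).2)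
    | .inr overflow, _ => if overflow then (none, .stay, []) else (some (.inl F.start), mv, [])

variable (F : SweepMachine α β (Fin K → Fin b)) (m : Fin K) (mv : Move)

theorem isPart_loop : F.IsPart (F.loop m mv) Sum.inl (some (.inr true)) :=
  ⟨fun _ _ => rfl, fun _ => rfl, fun _ _ => rfl⟩

theorem scan_loop_carry (σ : Fin K → ℕ) (s : Bool) :
    (F.loop m mv).scan (.inr s) (fun v => Fin.ofNat b (σ v)) =
      (.inr (decide (b ≤ σ m % b + s.toNat)),
        fun v => Fin.ofNat b (Function.update σ m (σ m + s.toNat) v)) := by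
  refine Prod.ext rfl (funext fun v => ?_)
  rcases eq_or_ne v m with rfl | hv
  · ext; simp [loop, Nat.add_mod]
  · simp [loop, Function.update_of_ne hv]

theorem sweep_loop_carry (L : ℕ) (σ : Fin K → ℕ) (s : Bool) (hσ : σ m < b ^ L) :
    (F.loop m mv).sweep (.inr s) (columns b L σ) =
      (.inr (decide (b ^ L ≤ σ m + s.toNat)),
        columns b L (Function.update σ m (σ m + s.toNat))) := by
  induction L generalizing σ s with
  | zero =>
    have h0 : σ m = 0 := by simpa using hσ
    cases s <;> simp [columns, sweep, loop, h0]
  | succ L ih =>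
    have hdiv : (fun v => Function.update σ m (σ m + s.toNat) v / b) =
        Function.update (fun v => σ v / b) m ((σ m + s.toNat) / b) := by
      funext v
      rcases eq_or_ne v m with rfl | hv
      · simp
      · simp [Function.update_of_ne hv]
    have hoverflow : b ^ L ≤ (σ m + s.toNat) / b ↔ b ^ (L + 1) ≤ σ m + s.toNat := by
      rw [Nat.le_div_iff_mul_le (NeZero.pos b), pow_succ]
    simp only [columns, sweep, scan_loop_carry]
    rw [ih (fun v => σ v / b) _ (div_lt_pow_of_lt_pow_succ hσ), ← add_carry_div, hdiv]
    simp only [hoverflow]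

variable {F m mv} {w : List α} {L : ℕ} {σ : Fin K → ℕ}

theorem runs_loop_overflow (h : ℕ) (hσ : σ m + 1 = b ^ L) :
    (F.loop m mv).Runs w (.inr true) h (columns b L σ) h (columns b L (Function.update σ m 0))
      [] := by
  have hsweep := F.sweep_loop_carry m mv L σ true (by lia)
  have hzero : columns b L (Function.update σ m (σ m + true.toNat)) =
      columns b L (Function.update σ m 0) := by
    refine columns_congr fun v => ?_
    rcases eq_or_ne v m with rfl | hv
    · simp [hσ]
    · simp [Function.update_of_ne hv]
  have run := Runs.exit (F := F.loop m mv) (w := w) (q := .inr true) (h := h)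
    (cs := columns b L σ) (m := .stay) (o := []) (by rw [hsweep]; simp [loop, hσ])
  rwa [hsweep, hzero] at run

theorem runs_loop_increment {h h' : ℕ} {cs : List (Fin K → Fin b)} {o : List β}
    (hσ : σ m + 1 < b ^ L)
    (r : (F.loop m mv).Runs w (.inl F.start) (moveInput w.length h mv)
      (columns b L (Function.update σ m (σ m + 1))) h' cs o) :
    (F.loop m mv).Runs w (.inr true) h (columns b L σ) h' cs o := by
  have hsweep := F.sweep_loop_carry m mv L σ true (by lia)
  refine .step (q' := Sum.inl F.start) (m := mv) (o := []) ?_ (by rw [hsweep]; exact r)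
  rw [hsweep]
  simp [loop, hσ.not_ge]

theorem runs_loop_from {H : ℕ → ℕ} (hH : ∀ i, moveInput w.length (H i) mv = H (i + 1))
    {f : ℕ → List β}
    (hF : ∀ i < b ^ L, F.Runs w F.start (H i) (columns b L (Function.update σ m i)) (H i)
      (columns b L (Function.update σ m i)) (f i)) (k i : ℕ) (hk : i + k + 1 = b ^ L) :
    (F.loop m mv).Runs w (.inl F.start) (H i) (columns b L (Function.update σ m i)) (H (i + k))
      (columns b L (Function.update σ m 0)) ((List.range' i (k + 1)).flatMap f) := by
  induction k generalizing i with
  | zero =>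
    have last := runs_loop_overflow (F := F) (m := m) (mv := mv) (w := w) (L := L) (H i)
      (σ := Function.update σ m i) (by simpa using hk)
    rw [Function.update_idem] at last
    simpa using (hF i (by lia)).append (F.isPart_loop m mv) last
  | succ k ih =>
    have rest := ih (i + 1) (by lia)
    rw [show i + 1 + k = i + (k + 1) by lia, ← hH] at rest
    rw [List.range'_succ, List.flatMap_cons]
    refine (hF i (by lia)).append (F.isPart_loop m mv) (runs_loop_increment ?_ ?_)
    · simp only [Function.update_self]; lia
    · simpa using rest

theorem runs_loop (hσ : σ m = 0) {H : ℕ → ℕ}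
    (hH : ∀ i, moveInput w.length (H i) mv = H (i + 1)) {f : ℕ → List β}
    (hF : ∀ i < b ^ L, F.Runs w F.start (H i) (columns b L (Function.update σ m i)) (H i)
      (columns b L (Function.update σ m i)) (f i)) :
    (F.loop m mv).Runs w (F.loop m mv).start (H 0) (columns b L σ) (H (b ^ L - 1))
      (columns b L σ) ((List.range (b ^ L)).flatMap f) := by
  have hpos : 0 < b ^ L := pow_pos (NeZero.pos b) L
  have run := runs_loop_from hH hF (b ^ L - 1) 0 (by lia)
  rwa [zero_add, Nat.sub_add_cancel hpos, ← List.range_eq_range',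
    show Function.update σ m 0 = σ by rw [← hσ, Function.update_eq_self]] at run

end SweepMachine

/-! ### Output produced with counters -/

/-- Output that depends on the input, the number of columns, the position of the input head and
the values of the counters. -/
abbrev Emission (α β : Type) (K : ℕ) : Type := List α → ℕ → ℕ → (Fin K → ℕ) → List β

/-- `f` is emitted by a machine that leaves the counters and the input head as they were, provided
that the counters from `m` on, which are those it may use for its own purposes, are zero and the
position of the input head satisfies `P`. -/
def Emits {α β : Type} {K : ℕ} (b : ℕ) [NeZero b] (m : ℕ) (P : ℕ → Prop) (f : Emission α β K) :
    Prop :=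
  ∃ F : SweepMachine α β (Fin K → Fin b), ∀ w L h σ, P h → (∀ v, σ v < b ^ L) →
    (∀ v : Fin K, m ≤ v → σ v = 0) →
    F.Runs w F.start h (columns b L σ) h (columns b L σ) (f w L h σ)

namespace Emits

open Transducer (inputTape moveInput)

theorem update_lt {K B : ℕ} {σ : Fin K → ℕ} (hσ : ∀ v, σ v < B) (m : Fin K) {i : ℕ} (hi : i < B)
    (v : Fin K) : Function.update σ m i v < B := by
  rcases eq_or_ne v m with rfl | hv
  · simpa
  · simpa [Function.update_of_ne hv] using hσ v

theorem update_eq_zero {K m : ℕ} {σ : Fin K → ℕ} (hσ : ∀ v : Fin K, m ≤ v → σ v = 0) (hm : m < K)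
    (i : ℕ) (v : Fin K) (hv : m + 1 ≤ v) : Function.update σ ⟨m, hm⟩ i v = 0 := by
  rw [Function.update_of_ne (by rintro rfl; simp at hv), hσ v (Nat.le_of_succ_le hv)]

variable {α β : Type} {K b : ℕ} [NeZero b] {m : ℕ} {P : ℕ → Prop} {f g : Emission α β K}

theorem congr (hf : Emits b m P f)
    (h : ∀ w L h σ, P h → (∀ v, σ v < b ^ L) → (∀ v : Fin K, m ≤ v → σ v = 0) →
      g w L h σ = f w L h σ) : Emits b m P g := by
  obtain ⟨F, hF⟩ := hf
  refine ⟨F, fun w L k σ hk hlt hzero => ?_⟩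
  rw [h w L k σ hk hlt hzero]
  exact hF w L k σ hk hlt hzero

theorem const (l : List β) : Emits b m P (fun _ _ _ _ => l : Emission α β K) :=
  ⟨.emit l .stay, fun w _ h _ _ _ _ => SweepMachine.runs_emit l .stay w h _⟩

theorem append (hf : Emits b m P f) (hg : Emits b m P g) :
    Emits b m P fun w L h σ => f w L h σ ++ g w L h σ := by
  obtain ⟨F, hF⟩ := hf
  obtain ⟨G, hG⟩ := hg
  exact ⟨F.seq G, fun w L h σ hh hlt hzero =>
    (hF w L h σ hh hlt hzero).seq (hG w L h σ hh hlt hzero)⟩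

theorem flatMap {ι : Type*} (l : List ι) {f : ι → Emission α β K} (hf : ∀ i, Emits b m P (f i)) :
    Emits b m P fun w L h σ => l.flatMap fun i => f i w L h σ := by
  induction l with
  | nil => exact const []
  | cons i l ih => exact (hf i).append ih

theorem branch {S J : Type} [Finite S] [Finite J] (s₀ : S) (δ : S → (Fin K → Fin b) → S)
    (out : S → InputCell α → J) {p : List α → ℕ → ℕ → (Fin K → ℕ) → J}
    (hp : ∀ w L h σ, (∀ v, σ v < b ^ L) →
      out ((columns b L σ).foldl δ s₀) (inputTape w h) = p w L h σ)
    {f : J → Emission α β K} (hf : ∀ j, Emits b m P (f j)) :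
    Emits b m P fun w L h σ => f (p w L h σ) w L h σ := by
  choose F hF using hf
  exact ⟨.branch s₀ δ out F, fun w L h σ hh hlt hzero =>
    .branch (hp w L h σ hlt) (hF _ w L h σ hh hlt hzero)⟩

theorem input [Finite α] {f : InputCell α → Emission α β K} (hf : ∀ x, Emits b m P (f x)) :
    Emits b m P fun w L h σ => f (inputTape w h) w L h σ :=
  branch () (fun _ _ => ()) (fun _ x => x) (fun _ _ _ _ _ => rfl) hf

theorem range (hm : m < K) (hf : Emits b (m + 1) P f) :
    Emits b m P fun w L h σ =>
      (List.range (b ^ L)).flatMap fun i => f w L h (Function.update σ ⟨m, hm⟩ i) := by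
  obtain ⟨F, hF⟩ := hf
  exact ⟨F.loop ⟨m, hm⟩ .stay, fun w L h σ hh hlt hzero =>
    SweepMachine.runs_loop (hzero ⟨m, hm⟩ le_rfl) (H := fun _ => h) (fun _ => rfl) fun i hi =>
      hF w L h _ hh (update_lt hlt _ hi) (update_eq_zero hzero hm i)⟩

theorem rangeInput (hm : m < K) (hf : Emits b (m + 1) (fun _ => True) f) :
    Emits b m (fun h => h = 0) fun w L _ σ => (List.range (b ^ L)).flatMap fun i =>
      f w L (min (i + 1) (w.length + 1)) (Function.update σ ⟨m, hm⟩ i) := by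
  obtain ⟨F, hF⟩ := hf
  refine ⟨((SweepMachine.emit [] .right).seq (F.loop ⟨m, hm⟩ .right)).seq .rewindInput,
    fun w L h σ hh hlt hzero => ?_⟩
  subst hh
  have loop := SweepMachine.runs_loop (F := F) (mv := .right) (w := w)
    (hzero ⟨m, hm⟩ le_rfl) (H := fun i => min (i + 1) (w.length + 1))
    (fun i => by simp only [moveInput]; lia) fun i hi =>
      hF w L _ _ trivial (update_lt hlt _ hi) (update_eq_zero hzero hm i)
  have run := ((SweepMachine.runs_emit [] .right w 0 (columns b L σ)).seq loop).seq
    (SweepMachine.runs_rewindInput w _ _)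
  simpa only [List.nil_append, List.append_nil] using run

end Emits

/-! ### Laying out logarithmically many columns -/

namespace SweepMachine

open Transducer (inputTape moveInput)

/-- The states of the machine `layout`: it creates the first column, then reads the input symbol by
symbol and increments a binary counter for each of them, and finally clears all columns. -/
inductive LayoutState where
  | create
  | read
  | increment (carry : Bool)
  | clear

instance : Finite LayoutState :=
  Finite.of_injective
    (fun s : LayoutState => match s with
      | .create => (Sum.inl 0 : Fin 3 ⊕ Bool)
      | .read => .inl 1
      | .increment carry => .inr carry
      | .clear => .inl 2)
    (by rintro (_ | _ | _ | _) (_ | _ | _ | _) h <;> simp_all)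

variable {α β : Type} {K b : ℕ} [NeZero b]

/-- The column all of whose digits are `d`. -/
def digit (K b : ℕ) [NeZero b] (d : ℕ) : Fin K → Fin b := fun _ => Fin.ofNat b d

theorem digit_one_ne_digit_zero (hK : 0 < K) (hb : 2 ≤ b) : digit K b 1 ≠ digit K b 0 := fun h => by
  have := congrArg Fin.val (congrFun h ⟨0, hK⟩)
  simp [digit, Nat.mod_eq_of_lt (show 1 < b by lia)] at this

/-- Counts the input symbols in binary, appending a column whenever the counter overflows, and then
sets all digits to zero. -/
def layout (α β : Type) (K b : ℕ) [NeZero b] : SweepMachine α β (Fin K → Fin b) where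
  Q := LayoutState
  finite_Q := inferInstance
  start := .create
  scan
    | .increment true, c =>
      if c = digit K b 0 then (.increment false, digit K b 1) else (.increment true, digit K b 0)
    | .clear, _ => (.clear, digit K b 0)
    | q, c => (q, c)
  append
    | .increment true => some (digit K b 1)
    | .create => some (digit K b 0)
    | _ => none
  next
    | .increment _, _ => (some .read, .right, [])
    | .create, _ => (some .read, .right, [])
    | .read, .sym _ => (some (.increment true), .stay, [])
    | .read, _ => (some .clear, .stay, [])
    | .clear, .leftEnd => (none, .stay, [])
    | .clear, _ => (some .clear, .left, [])

/-- The number written in binary in the columns. -/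
def binary : List (Fin K → Fin b) → ℕ
  | [] => 0
  | c :: cs => (if c = digit K b 0 then 0 else 1) + 2 * binary cs

theorem binary_lt (cs : List (Fin K → Fin b)) : binary cs < 2 ^ cs.length := by
  induction cs with
  | nil => simp [binary]
  | cons c cs ih => simp only [binary, List.length_cons, pow_succ]; split_ifs <;> lia

theorem sweep_layout_read (cs : List (Fin K → Fin b)) :
    (layout α β K b).sweep .read cs = (.read, cs) :=
  sweep_of_readOnly (F := layout α β K b) (S := Unit) (fun _ => .read) (fun _ _ => ())
    (fun _ _ => rfl) (fun _ => rfl) () cs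

theorem sweep_layout_no_carry (cs : List (Fin K → Fin b)) :
    (layout α β K b).sweep (.increment false) cs = (.increment false, cs) :=
  sweep_of_readOnly (F := layout α β K b) (S := Unit) (fun _ => .increment false) (fun _ _ => ())
    (fun _ _ => rfl) (fun _ => rfl) () cs

theorem sweep_layout_clear (cs : List (Fin K → Fin b)) :
    (layout α β K b).sweep .clear cs = (.clear, columns b cs.length fun _ => 0) := by
  induction cs with
  | nil => rfl
  | cons c cs ih =>
    have hc : (layout α β K b).scan .clear c = (.clear, digit K b 0) := rfl
    simp only [sweep, hc, ih, List.length_cons, columns, Nat.zero_div]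
    rfl

theorem sweep_layout_carry_zero (cs : List (Fin K → Fin b)) :
    (layout α β K b).sweep (.increment true) (digit K b 0 :: cs) =
      (.increment false, digit K b 1 :: cs) := by
  have hc : (layout α β K b).scan (.increment true) (digit K b 0) =
    (.increment false, digit K b 1) := by simp [layout]
  simp only [sweep, hc, sweep_layout_no_carry]

theorem sweep_layout_carry_one {c : Fin K → Fin b} (hc : c ≠ digit K b 0)
    (cs : List (Fin K → Fin b)) :
    (layout α β K b).sweep (.increment true) (c :: cs) =
      (((layout α β K b).sweep (.increment true) cs).1,
        digit K b 0 :: ((layout α β K b).sweep (.increment true) cs).2) := by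
  have hscan : (layout α β K b).scan (.increment true) c = (.increment true, digit K b 0) := by
    simp [layout, hc]
  simp only [sweep, hscan]

theorem exists_sweep_layout_carry (hne : digit K b 1 ≠ digit K b 0) (cs : List (Fin K → Fin b)) :
    ∃ carry cs', (layout α β K b).sweep (.increment true) cs = (.increment carry, cs') ∧
      binary cs' = binary cs + 1 ∧
      (cs'.length = cs.length ∨ cs'.length = cs.length + 1 ∧ binary cs + 1 = 2 ^ cs.length) := by
  induction cs with
  | nil => exact ⟨true, [digit K b 1], rfl, by simp [binary, hne], by simp [binary]⟩
  | cons c cs ih =>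
    rcases eq_or_ne c (digit K b 0) with rfl | hc
    · exact ⟨false, _, sweep_layout_carry_zero cs, by simp [binary, hne]; lia, .inl rfl⟩
    · obtain ⟨carry, cs', hsweep, hbinary, hlength⟩ := ih
      refine ⟨carry, digit K b 0 :: cs', by rw [sweep_layout_carry_one hc, hsweep], ?_, ?_⟩
      · simp only [binary, hc, hbinary, if_true, if_false]; lia
      · simp only [binary, hc, List.length_cons, pow_succ, if_false]; lia

theorem runs_layout_clear (w : List α) (h : ℕ) (cs : List (Fin K → Fin b)) :
    (layout α β K b).Runs w .clear h cs 0 (columns b cs.length fun _ => 0) [] := by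
  induction h generalizing cs with
  | zero =>
    have run := Runs.exit (F := layout α β K b) (w := w) (q := .clear) (h := 0) (cs := cs)
      (m := .stay) (o := []) (by rw [sweep_layout_clear]; rfl)
    rwa [sweep_layout_clear] at run
  | succ h ih =>
    refine .step (F := layout α β K b) (q' := .clear) (m := .left) (o := []) ?_ ?_
    · rw [sweep_layout_clear]
      cases hx : w[h]? <;> simp [layout, inputTape, hx]
    · rw [sweep_layout_clear]
      have rest := ih (columns b cs.length fun _ => 0)
      rwa [length_columns] at rest

theorem runs_layout_read_end (w : List α) (cs : List (Fin K → Fin b)) :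
    (layout α β K b).Runs w .read (w.length + 1) cs 0 (columns b cs.length fun _ => 0) [] := by
  refine .step (F := layout α β K b) (q' := .clear) (m := .stay) (o := []) ?_ ?_
  · rw [sweep_layout_read]
    simp [layout, inputTape]
  · rw [sweep_layout_read]
    exact runs_layout_clear w _ cs

theorem runs_layout_read_sym {w : List α} {t h' : ℕ} {carry : Bool}
    {cs cs' cs'' : List (Fin K → Fin b)} {o : List β} (ht : t < w.length)
    (hcs : (layout α β K b).sweep (.increment true) cs = (.increment carry, cs'))
    (r : (layout α β K b).Runs w .read (t + 2) cs' h' cs'' o) :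
    (layout α β K b).Runs w .read (t + 1) cs h' cs'' o := by
  refine .step (F := layout α β K b) (q' := .increment true) (m := .stay) (o := []) ?_
    (.step (F := layout α β K b) (q' := .read) (m := .right) (o := []) ?_ ?_)
  · rw [sweep_layout_read]
    simp [layout, inputTape, ht]
  · rw [sweep_layout_read, hcs]
    rfl
  · rw [sweep_layout_read, hcs,
      show moveInput w.length (moveInput w.length (t + 1) .stay) .right = t + 2 by
        simp only [moveInput]; lia]
    exact r

theorem runs_layout_read (hne : digit K b 1 ≠ digit K b 0) (w : List α) (k t : ℕ)
    (hk : t + k = w.length) (cs : List (Fin K → Fin b)) (hcs : 1 ≤ cs.length)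
    (ht : binary cs = t) (hb : 2 ^ cs.length ≤ 2 * t + 2) :
    ∃ L, 1 ≤ L ∧ w.length < 2 ^ L ∧ 2 ^ L ≤ 2 * w.length + 2 ∧
      (layout α β K b).Runs w .read (t + 1) cs 0 (columns b L fun _ => 0) [] := by
  induction k generalizing t cs with
  | zero =>
    obtain rfl : t = w.length := hk
    exact ⟨cs.length, hcs, ht ▸ binary_lt cs, hb, runs_layout_read_end w cs⟩
  | succ k ih =>
    obtain ⟨carry, cs', hsweep, hbinary, hlength⟩ :=
      exists_sweep_layout_carry (α := α) (β := β) hne cs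
    have hpow : 2 ^ cs'.length ≤ 2 * (t + 1) + 2 := by
      rcases hlength with hlength | ⟨hlength, hfull⟩
      · rw [hlength]; lia
      · rw [hlength, pow_succ]; lia
    obtain ⟨L, hpos, hlt, hle, run⟩ := ih (t + 1) (by lia) cs' (by lia) (by lia) hpow
    exact ⟨L, hpos, hlt, hle, runs_layout_read_sym (by lia) hsweep run⟩

theorem runs_layout (hne : digit K b 1 ≠ digit K b 0) (w : List α) :
    ∃ L, 1 ≤ L ∧ w.length < 2 ^ L ∧ 2 ^ L ≤ 2 * w.length + 2 ∧
      (layout α β K b).Runs w (layout α β K b).start 0 [] 0 (columns b L fun _ => 0) [] := by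
  obtain ⟨L, hpos, hlt, hle, run⟩ := runs_layout_read (α := α) (β := β) hne w w.length 0 (by lia)
    [digit K b 0] (by simp) (by simp [binary]) (by simp)
  refine ⟨L, hpos, hlt, hle, ?_⟩
  refine .step (F := layout α β K b) (q' := .read) (m := .right) (o := []) rfl ?_
  rw [show moveInput w.length 0 .right = 0 + 1 by simp only [moveInput]; lia]
  exact run

theorem le_log_of_two_pow_le {L n : ℕ} (h : 2 ^ L ≤ 2 * n + 2) : L ≤ 2 * (Nat.log 2 n + 1) := by
  have hn : n < 2 ^ (Nat.log 2 n + 1) := Nat.lt_pow_succ_log_self one_lt_two n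
  have hL : 2 ^ L ≤ 2 ^ (Nat.log 2 n + 2) := by rw [pow_succ 2 (_ + 1)]; lia
  have := (Nat.pow_le_pow_iff_right one_lt_two).1 hL
  lia

end SweepMachine

theorem Emits.logSpaceComputable {α β : Type} {K b : ℕ} [NeZero b] (hK : 0 < K) (hb : 2 ≤ b)
    {f : Emission α β K} (hf : Emits b 0 (fun h => h = 0) f) :
    ∃ L : List α → ℕ, (∀ w, 1 ≤ L w ∧ w.length < 2 ^ L w) ∧
      LogSpaceComputable fun w => f w (L w) 0 fun _ => 0 := by
  obtain ⟨F, hF⟩ := hf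
  choose L hpos hlt hle run using SweepMachine.runs_layout (α := α) (β := β)
    (SweepMachine.digit_one_ne_digit_zero hK hb)
  refine ⟨L, fun w => ⟨hpos w, hlt w⟩, ((SweepMachine.layout α β K b).seq F).logSpaceComputable 2
    fun w => ⟨0, columns b (L w) fun _ => 0, ?_, ?_⟩⟩
  · rw [length_columns]
    exact SweepMachine.le_log_of_two_pow_le (hle w)
  · exact (run w).seq (hF w (L w) 0 _ rfl (fun _ => pow_pos (NeZero.pos b) _) fun _ _ => rfl)

/-! ### Comparing counters -/

section compare

variable {K b : ℕ}

theorem eq_iff_div_eq_and_mod_eq (x y : ℕ) : x = y ↔ x / b = y / b ∧ x % b = y % b :=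
  ⟨fun h => by simp [h], fun ⟨hd, hm⟩ => by
    rw [← Nat.div_add_mod x b, ← Nat.div_add_mod y b, hd, hm]⟩

theorem lt_iff_div_lt_or_mod_lt (x y : ℕ) :
    x < y ↔ x / b < y / b ∨ x / b = y / b ∧ x % b < y % b := by
  refine ⟨fun h => ?_, ?_⟩
  · rcases (Nat.div_le_div_right (c := b) h.le).lt_or_eq with hd | hd
    · exact .inl hd
    · refine .inr ⟨hd, ?_⟩
      have hx := Nat.div_add_mod x b
      have hy := Nat.div_add_mod y b
      rw [hd] at hx
      lia
  · rintro (hd | ⟨hd, hm⟩)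
    · exact lt_of_not_ge fun h => hd.not_ge (Nat.div_le_div_right h)
    · rw [← Nat.div_add_mod x b, ← Nat.div_add_mod y b, hd]
      exact Nat.add_lt_add_left hm _

variable [NeZero b]

theorem foldl_columns_zero (i : Fin K) (L : ℕ) (σ : Fin K → ℕ) (s : Bool) (hi : σ i < b ^ L) :
    (columns b L σ).foldl (fun s c => s && decide (c i = 0)) s = (s && decide (σ i = 0)) := by
  induction L generalizing σ s with
  | zero => simp [columns, show σ i = 0 by simpa using hi]
  | succ L ih =>
    simp only [columns, List.foldl_cons]
    rw [ih (fun v => σ v / b) _ (div_lt_pow_of_lt_pow_succ hi), Bool.eq_iff_iff]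
    simp only [Bool.and_eq_true, decide_eq_true_eq, eq_iff_div_eq_and_mod_eq (b := b) (σ i) 0,
      Nat.zero_div, Nat.zero_mod, Fin.ext_iff, Fin.val_ofNat, Fin.val_zero]
    tauto

theorem foldl_columns_lt (i j : Fin K) (L : ℕ) (σ : Fin K → ℕ) (s : Bool) (hi : σ i < b ^ L)
    (hj : σ j < b ^ L) :
    (columns b L σ).foldl (fun s c => if c i = c j then s else decide (c i < c j)) s =
      if σ i = σ j then s else decide (σ i < σ j) := by
  induction L generalizing σ s with
  | zero => simp [columns, show σ i = 0 by simpa using hi, show σ j = 0 by simpa using hj]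
  | succ L ih =>
    simp only [columns, List.foldl_cons]
    rw [ih (fun v => σ v / b) _ (div_lt_pow_of_lt_pow_succ hi) (div_lt_pow_of_lt_pow_succ hj)]
    simp only [Fin.ext_iff, Fin.lt_def, Fin.val_ofNat, eq_iff_div_eq_and_mod_eq (b := b) (σ i),
      lt_iff_div_lt_or_mod_lt (b := b) (σ i)]
    by_cases hd : σ i / b = σ j / b <;> by_cases hm : σ i % b = σ j % b <;> simp [hd, hm]

theorem foldl_columns_succ (i j : Fin K) (L : ℕ) (σ : Fin K → ℕ) (s t : Bool)
    (hi : σ i < b ^ L) (hj : σ j < b ^ L) :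
    ((columns b L σ).foldl (fun s c => (decide (b ≤ (c i : ℕ) + s.1.toNat),
        s.2 && decide (c j = Fin.ofNat b (c i + s.1.toNat)))) (s, t)).2 =
      (t && decide (σ j = (σ i + s.toNat) % b ^ L)) := by
  induction L generalizing σ s t with
  | zero => simp [columns, show σ i = 0 by simpa using hi, show σ j = 0 by simpa using hj,
      Nat.mod_one]
  | succ L ih =>
    have hmod : (σ i + s.toNat) % b ^ (L + 1) % b = (σ i + s.toNat) % b := by
      rw [pow_succ, Nat.mod_mul_left_mod]
    have hdiv : (σ i + s.toNat) % b ^ (L + 1) / b = (σ i + s.toNat) / b % b ^ L := by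
      rw [pow_succ', Nat.mod_mul_right_div_self]
    simp only [columns, List.foldl_cons]
    rw [ih (fun v => σ v / b) _ _ (div_lt_pow_of_lt_pow_succ hi) (div_lt_pow_of_lt_pow_succ hj),
      Bool.eq_iff_iff]
    simp only [Bool.and_eq_true, decide_eq_true_eq, eq_iff_div_eq_and_mod_eq (b := b) (σ j), hmod,
      hdiv, Fin.ext_iff, Fin.val_ofNat, Nat.mod_add_mod, ← add_carry_div]
    tauto

end compare

section flatMap

variable {β : Type}

theorem flatMap_range_ite_lt {x B : ℕ} (hx : x ≤ B) (l : List β) :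
    ((List.range B).flatMap fun t => if t < x then l else []) = (List.replicate x l).flatten := by
  induction B, hx using Nat.le_induction with
  | base =>
    rw [List.flatMap_def, ← List.length_range (n := x), ← List.map_const', List.length_range]
    exact congrArg _ (List.map_congr_left fun t ht => if_pos (List.mem_range.1 ht))
  | succ B hB ih => simp [List.range_succ, ih, not_lt.2 hB]

theorem flatMap_range_ite_eq {x B : ℕ} (hx : x < B) (g : ℕ → List β) :
    ((List.range B).flatMap fun t => if t = x then g t else []) = g x := by
  induction B, hx using Nat.le_induction with
  | base =>
    have hnil : ((List.range x).flatMap fun t => if t = x then g t else []) = [] :=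
      List.flatMap_eq_nil_iff.2 fun t ht => if_neg (List.mem_range.1 ht).ne
    simp [List.range_succ, hnil]
  | succ B hB ih => simp [List.range_succ, ih, (Nat.lt_of_succ_le hB).ne']

end flatMap

namespace Emits

variable {α β : Type} {K b : ℕ} [NeZero b] {m : ℕ} {P : ℕ → Prop} {f g : Emission α β K}

theorem ite {S : Type} [Finite S] (s₀ : S) (δ : S → (Fin K → Fin b) → S) (out : S → Bool)
    {p : ℕ → (Fin K → ℕ) → Prop} [∀ L σ, Decidable (p L σ)]
    (hp : ∀ L σ, (∀ v, σ v < b ^ L) → out ((columns b L σ).foldl δ s₀) = decide (p L σ))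
    (hf : Emits b m P f) (hg : Emits b m P g) :
    Emits b m P fun w L h σ => if p L σ then f w L h σ else g w L h σ := by
  refine (branch s₀ δ (fun s _ => out s) (p := fun _ L _ σ => decide (p L σ))
    (fun _ L _ σ => hp L σ) (f := fun c w L h σ => if c then f w L h σ else g w L h σ)
    fun c => ?_).congr fun w L h σ _ _ _ => by simp
  cases c
  · exact hg
  · exact hf

theorem ite_zero (i : Fin K) (hf : Emits b m P f) (hg : Emits b m P g) :
    Emits b m P fun w L h σ => if σ i = 0 then f w L h σ else g w L h σ :=
  ite true (fun s c => s && decide (c i = 0)) id (p := fun _ σ => σ i = 0)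
    (fun L σ hσ => foldl_columns_zero i L σ true (hσ i)) hf hg

theorem ite_lt (i j : Fin K) (hf : Emits b m P f) (hg : Emits b m P g) :
    Emits b m P fun w L h σ => if σ i < σ j then f w L h σ else g w L h σ :=
  ite false (fun s c => if c i = c j then s else decide (c i < c j)) id
    (p := fun _ σ => σ i < σ j)
    (fun L σ hσ => (foldl_columns_lt i j L σ false (hσ i) (hσ j)).trans
      (by split_ifs with h <;> simp [h])) hf hg

theorem ite_cyclicSucc (i j : Fin K) (hf : Emits b m P f) (hg : Emits b m P g) :
    Emits b m P fun w L h σ => if σ j = (σ i + 1) % b ^ L then f w L h σ else g w L h σ :=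
  ite (true, true) (fun s c => (decide (b ≤ (c i : ℕ) + s.1.toNat),
      s.2 && decide (c j = Fin.ofNat b (c i + s.1.toNat)))) Prod.snd
    (p := fun L σ => σ j = (σ i + 1) % b ^ L)
    (fun L σ hσ => foldl_columns_succ i j L σ true true (hσ i) (hσ j)) hf hg

theorem replicate_counter (hm : m < K) (i : Fin K) (hi : i < m) (l : List β) :
    Emits b m P (fun _ _ _ σ => (List.replicate (σ i) l).flatten : Emission α β K) := by
  have hne : i ≠ ⟨m, hm⟩ := by rintro rfl; simp at hi
  refine (range hm (ite_lt ⟨m, hm⟩ i (const l) (const []))).congr fun w L h σ _ hσ _ => ?_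
  simp only [Function.update_self, Function.update_of_ne hne]
  exact (flatMap_range_ite_lt (hσ i).le l).symm

theorem update_cyclicSucc (hm : m < K) (i : Fin K) (hi : i < m) (hf : Emits b (m + 1) P f) :
    Emits b m P fun w L h σ => f w L h (Function.update σ ⟨m, hm⟩ ((σ i + 1) % b ^ L)) := by
  have hne : i ≠ ⟨m, hm⟩ := by rintro rfl; simp at hi
  refine (range hm (ite_cyclicSucc i ⟨m, hm⟩ hf (const []))).congr fun w L h σ _ _ _ => ?_
  simp only [Function.update_self, Function.update_of_ne hne]
  exact (flatMap_range_ite_eq (Nat.mod_lt (σ i + 1) (pow_pos (NeZero.pos b) L))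
    fun t => f w L h (Function.update σ ⟨m, hm⟩ t)).symm

end Emits

/-! ### Quantified Boolean formulas -/

/-- Quantified Boolean formulas in negation normal form, with variables in `V`. -/
inductive QBF (V : Type) where
  | tt | ff
  | lit (b : Bool) (v : V)
  | and (φ ψ : QBF V)
  | or (φ ψ : QBF V)
  | ex (v : V) (φ : QBF V)
  | all (v : V) (φ : QBF V)

namespace QBF

variable {V X : Type}

open Classical in
/-- Truth of a quantified Boolean formula under an assignment. -/
def Sat : QBF V → (V → Bool) → Prop
  | tt, _ => True
  | ff, _ => False
  | lit b v, e => e v = b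
  | and φ ψ, e => φ.Sat e ∧ ψ.Sat e
  | or φ ψ, e => φ.Sat e ∨ ψ.Sat e
  | ex v φ, e => ∃ b, φ.Sat (Function.update e v b)
  | all v φ, e => ∀ b, φ.Sat (Function.update e v b)

theorem sat_foldr_and (l : List X) (F : X → QBF V) (φ : QBF V) (e : V → Bool) :
    (l.foldr (fun x ψ => (F x).and ψ) φ).Sat e ↔ (∀ x ∈ l, (F x).Sat e) ∧ φ.Sat e := by
  induction l with
  | nil => simp
  | cons x l ih => simp [Sat, ih, and_assoc]

theorem sat_foldr_or (l : List X) (F : X → QBF V) (φ : QBF V) (e : V → Bool) :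
    (l.foldr (fun x ψ => (F x).or ψ) φ).Sat e ↔ (∃ x ∈ l, (F x).Sat e) ∨ φ.Sat e := by
  induction l with
  | nil => simp
  | cons x l ih => simp [Sat, ih, or_assoc]

/-- The formula stating that two variables have the same value. -/
def same (v w : V) : QBF V := ((lit true v).and (lit true w)).or ((lit false v).and (lit false w))

theorem sat_same (v w : V) (e : V → Bool) : (same v w).Sat e ↔ e v = e w := by
  cases hv : e v <;> cases hw : e w <;> simp [same, Sat, hv, hw]

end QBF

theorem exists_update_iff_exists_eqOn_compl {V W X : Type*} [DecidableEq V] (l : List X)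
    (v : X → V) (x : X) (Q : (V → W) → Prop) (e : V → W) :
    (∃ a, ∃ e', Set.EqOn e' (Function.update e (v x) a) {y | ∃ x ∈ l, v x = y}ᶜ ∧ Q e') ↔
      ∃ e', Set.EqOn e' e {y | ∃ z ∈ x :: l, v z = y}ᶜ ∧ Q e' := by
  constructor
  · rintro ⟨a, e', he, hQ⟩
    refine ⟨e', fun y hy => ?_, hQ⟩
    rw [he fun ⟨z, hz, h⟩ => hy ⟨z, List.mem_cons_of_mem _ hz, h⟩,
      Function.update_of_ne fun h => hy ⟨x, List.mem_cons_self, h.symm⟩]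
  · rintro ⟨e', he, hQ⟩
    refine ⟨e' (v x), e', fun y hy => ?_, hQ⟩
    by_cases hxy : y = v x
    · rw [hxy, Function.update_self]
    · rw [Function.update_of_ne hxy]
      refine he fun ⟨z, hz, h⟩ => ?_
      rcases List.mem_cons.1 hz with rfl | hz
      exacts [hxy h.symm, hy ⟨z, hz, h⟩]

theorem foldr_exists_update_iff {V W X Φ : Type*} [DecidableEq V] {Q : Φ → (V → W) → Prop}
    {ex : V → Φ → Φ} (hex : ∀ v φ e, Q (ex v φ) e ↔ ∃ a, Q φ (Function.update e v a))
    (l : List X) (v : X → V) (φ : Φ) (e : V → W) :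
    Q (l.foldr (fun x ψ => ex (v x) ψ) φ) e ↔
      ∃ e', Set.EqOn e' e {y | ∃ x ∈ l, v x = y}ᶜ ∧ Q φ e' := by
  induction l generalizing e with
  | nil => simp [Set.EqOn, ← funext_iff]
  | cons x l ih => simp only [List.foldr_cons, hex, ih, exists_update_iff_exists_eqOn_compl]

open Classical in
theorem QBF.sat_foldr_ex {V X : Type} (l : List X) (v : X → V) (φ : QBF V) (e : V → Bool) :
    (l.foldr (fun x ψ => ex (v x) ψ) φ).Sat e ↔
      ∃ e', Set.EqOn e' e {y | ∃ x ∈ l, v x = y}ᶜ ∧ φ.Sat e' :=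
  foldr_exists_update_iff (fun _ _ _ => Iff.rfl) l v φ e

/-! ### Iterating a cellular automaton -/

/-- The kinds of Boolean variables: `none` for a variable that selects one of two halves of a
computation, and `some (a, s)` for the bit `s` of a cell of the configuration `a`. -/
abbrev Kind (ι : Type) : Type := Option (Fin 5 × ι)

/-- Boolean variables about configurations of a cellular automaton whose cells hold `ι` bits: a kind
and the number of a cell. -/
abbrev QVar (ι : Type) : Type := Kind ι × ℕ

/-- The local rules of cellular automata whose cells hold `ι` bits: the new content of a cell as a
function of the contents of its left neighbour, of itself and of its right neighbour. -/
abbrev LocalRule (ι : Type) : Type := (ι → Bool) → (ι → Bool) → (ι → Bool) → ι → Bool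

/-- The global map of the cellular automaton with local rule `g` on a cycle of length `B`. -/
def globalMap {W : Type} (B : ℕ) [NeZero B] (g : W → W → W → W) (x : Fin B → W) : Fin B → W :=
  fun j => g (x (j - 1)) (x j) (x (j + 1))

namespace QVar

variable {ι : Type}

/-- The variable for the bit `s` of cell `i` in configuration `a`. -/
def bit (a : Fin 5) (s : ι) (i : ℕ) : QVar ι := (some (a, s), i)

/-- The variable that selects one of two halves. -/
def half : QVar ι := (none, 0)

/-- The configurations that an assignment describes. -/
def config (B : ℕ) (e : QVar ι → Bool) (a : Fin 5) : Fin B → ι → Bool :=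
  fun i s => e (bit a s i)

/-- The assignment `e` with configuration `a` replaced by `x`. -/
def setConfig {B : ℕ} (e : QVar ι → Bool) (a : Fin 5) (x : Fin B → ι → Bool) : QVar ι → Bool
  | (some (c, s), i) => if h : c = a ∧ i < B then x ⟨i, h.2⟩ s else e (bit c s i)
  | (none, i) => e (none, i)

variable {B : ℕ} (e : QVar ι → Bool) (a : Fin 5) (x : Fin B → ι → Bool)

theorem config_setConfig : config B (setConfig e a x) = Function.update (config B e) a x := by
  funext c i s
  by_cases hc : c = a
  · subst hc; simp [config, setConfig, bit]
  · simp [config, setConfig, bit, hc]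

theorem setConfig_half : setConfig e a x half = e half := rfl

theorem config_update_half [DecidableEq (QVar ι)] (b : Bool) :
    config B (Function.update e half b) = config B e := by
  funext c i s
  exact Function.update_of_ne (by simp [bit, half]) _ _

end QVar

namespace QBF

open QVar

variable {ι : Type} [Fintype ι]

/-- All pairs of a cell and a bit. -/
noncomputable def cells (ι : Type) [Fintype ι] (B : ℕ) : List (ℕ × ι) :=
  (List.range B).flatMap fun i => (Finset.univ : Finset ι).toList.map fun s => (i, s)

theorem mem_cells {B : ℕ} {p : ℕ × ι} : p ∈ cells ι B ↔ p.1 < B := by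
  obtain ⟨i, s⟩ := p
  simp [cells]

theorem length_cells (B : ℕ) : (cells ι B).length = B * Fintype.card ι := by
  simp [cells, List.length_flatMap]

/-- Existential quantification over configuration `a`. -/
noncomputable def exConfig (B : ℕ) (a : Fin 5) (φ : QBF (QVar ι)) : QBF (QVar ι) :=
  (cells ι B).foldr (fun p φ => ex (bit a p.2 p.1) φ) φ

theorem sat_exConfig {B : ℕ} {a : Fin 5} {φ : QBF (QVar ι)} {e : QVar ι → Bool} :
    (exConfig B a φ).Sat e ↔ ∃ x : Fin B → ι → Bool, φ.Sat (setConfig e a x) := by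
  rw [exConfig, sat_foldr_ex]
  constructor
  · rintro ⟨e', he, hφ⟩
    refine ⟨config B e' a, ?_⟩
    convert hφ using 1
    funext v
    rcases v with ⟨_ | ⟨c, s⟩, i⟩
    · exact (he fun ⟨p, _, hp⟩ => by simp [bit] at hp).symm
    · by_cases h : c = a ∧ i < B
      · simp [setConfig, config, bit, h]
      · rw [setConfig, dif_neg h]
        refine (he fun ⟨p, hp, hpv⟩ => h ?_).symm
        simp only [bit, Prod.mk.injEq, Option.some.injEq] at hpv
        exact ⟨hpv.1.1.symm, hpv.2 ▸ mem_cells.1 hp⟩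
  · rintro ⟨x, hφ⟩
    refine ⟨_, fun v hv => ?_, hφ⟩
    rcases v with ⟨_ | ⟨c, s⟩, i⟩
    · rfl
    · refine dif_neg fun h => hv ⟨(i, s), mem_cells.2 h.2, ?_⟩
      rw [bit, h.1]

/-- The formula stating that configurations `a` and `c` are equal. -/
noncomputable def sameConfig (B : ℕ) (a c : Fin 5) : QBF (QVar ι) :=
  (cells ι B).foldr (fun p φ => (same (bit a p.2 p.1) (bit c p.2 p.1)).and φ) tt

theorem sat_sameConfig {B : ℕ} {a c : Fin 5} {e : QVar ι → Bool} :
    (sameConfig B a c).Sat e ↔ config B e a = config B e c := by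
  simp only [sameConfig, sat_foldr_and, mem_cells, sat_same, Prod.forall, Sat, and_true,
    funext_iff, config, Fin.forall_iff]
  exact ⟨fun h i hi s => h i s hi, fun h i s hi => h i hi s⟩

/-- The formula stating that cell `i` of configuration `a` contains `x`. -/
noncomputable def cellIs (a : Fin 5) (x : ι → Bool) (i : ℕ) : QBF (QVar ι) :=
  (Finset.univ : Finset ι).toList.foldr (fun s φ => (lit (x s) (bit a s i)).and φ) tt

theorem sat_cellIs {B : ℕ} (a : Fin 5) (x : ι → Bool) (i : Fin B) (e : QVar ι → Bool) :
    (cellIs a x i).Sat e ↔ config B e a i = x := by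
  simp [cellIs, sat_foldr_and, Sat, config, funext_iff]

/-- The formula stating that configuration `0` is `x`. -/
noncomputable def initial (B : ℕ) (x : ℕ → ι → Bool) : QBF (QVar ι) :=
  (List.range B).foldr (fun i φ => (cellIs 0 (x i) i).and φ) tt

theorem sat_initial {B : ℕ} {x : ℕ → ι → Bool} {e : QVar ι → Bool} :
    (initial B x).Sat e ↔ config B e 0 = fun i : Fin B => x i := by
  simp only [initial, sat_foldr_and, List.mem_range, Sat, and_true, ← Fin.forall_iff
    (p := fun i => (cellIs 0 (x i) i).Sat e), sat_cellIs, funext_iff]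

open Classical in
/-- The formula stating that cell `j` of configuration `1` results by the rule `g` from the cells
`i`, `j` and `k` of configuration `0`. -/
noncomputable def localStep (g : LocalRule ι) (i j k : ℕ) : QBF (QVar ι) :=
  (Finset.univ : Finset ((ι → Bool) × (ι → Bool) × (ι → Bool))).toList.foldr (fun x φ =>
    ((cellIs 0 x.1 i).and ((cellIs 0 x.2.1 j).and ((cellIs 0 x.2.2 k).and
      (cellIs 1 (g x.1 x.2.1 x.2.2) j)))).or φ) ff

theorem sat_localStep {B : ℕ} (g : LocalRule ι) (i j k : Fin B) (e : QVar ι → Bool) :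
    (localStep g i j k).Sat e ↔
      config B e 1 j = g (config B e 0 i) (config B e 0 j) (config B e 0 k) := by
  simp [localStep, sat_foldr_or, Sat, sat_cellIs]

/-- The formula stating that configuration `1` is the successor of configuration `0`. -/
noncomputable def globalStep (B : ℕ) (g : LocalRule ι) : QBF (QVar ι) :=
  (List.range B).foldr
    (fun i φ => (localStep g i ((i + 1) % B) (((i + 1) % B + 1) % B)).and φ) tt

theorem sat_globalStep {B : ℕ} [NeZero B] {g : LocalRule ι} {e : QVar ι → Bool} :
    (globalStep B g).Sat e ↔ config B e 1 = globalMap B g (config B e 0) := by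
  have hsucc (i : Fin B) : ((i : ℕ) + 1) % B = ((i + 1 : Fin B) : ℕ) := by simp [Fin.val_add]
  have hstep (i : Fin B) : (localStep g i ((i + 1) % B) (((i + 1) % B + 1) % B)).Sat e ↔
      config B e 1 (i + 1) = globalMap B g (config B e 0) (i + 1) := by
    rw [hsucc, hsucc, sat_localStep, globalMap, add_sub_cancel_right]
  rw [globalStep, sat_foldr_and, funext_iff, ← (Equiv.addRight (1 : Fin B)).forall_congr_right]
  simp only [List.mem_range, Sat, and_true, Equiv.coe_addRight, ← hstep, Fin.forall_iff]

/-- The formula stating that configurations `3` and `4` are the first and the last configuration of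
the selected half of a computation that starts in `0`, ends in `1` and has `2` in the middle. -/
noncomputable def selectHalf (B : ℕ) : QBF (QVar ι) :=
  ((lit true half).and ((sameConfig B 3 0).and (sameConfig B 4 2))).or
    ((lit false half).and ((sameConfig B 3 2).and (sameConfig B 4 1)))

/-- The instance of `φ` with configurations `3` and `4` in place of `0` and `1`. -/
noncomputable def relocate (B : ℕ) (φ : QBF (QVar ι)) : QBF (QVar ι) :=
  exConfig B 0 (exConfig B 1 ((sameConfig B 0 3).and ((sameConfig B 1 4).and φ)))

/-- One level of the recursion by halving: guess a middle configuration and continue with either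
half. That `φ` occurs only once keeps the formula short. -/
noncomputable def level (B : ℕ) (φ : QBF (QVar ι)) : QBF (QVar ι) :=
  exConfig B 2 (all half (exConfig B 3 (exConfig B 4 ((selectHalf B).and (relocate B φ)))))

variable {B : ℕ}

theorem sat_selectHalf {e : QVar ι → Bool} : (selectHalf B).Sat e ↔
    config B e 3 = (if e half then config B e 0 else config B e 2) ∧
      config B e 4 = if e half then config B e 2 else config B e 1 := by
  cases h : e half <;> simp [selectHalf, Sat, sat_sameConfig, h]

variable {R : (Fin B → ι → Bool) → (Fin B → ι → Bool) → Prop} {φ : QBF (QVar ι)}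

theorem sat_relocate (hφ : ∀ e, φ.Sat e ↔ R (config B e 0) (config B e 1)) {e : QVar ι → Bool} :
    (relocate B φ).Sat e ↔ R (config B e 3) (config B e 4) := by
  simp [relocate, Sat, sat_exConfig, sat_sameConfig, hφ, config_setConfig, Function.update]

theorem sat_level (hφ : ∀ e, φ.Sat e ↔ R (config B e 0) (config B e 1)) {e : QVar ι → Bool} :
    (level B φ).Sat e ↔ ∃ x, R (config B e 0) x ∧ R x (config B e 1) := by
  simp [level, Sat, sat_exConfig, sat_selectHalf, sat_relocate hφ, config_setConfig,
    config_update_half, setConfig_half, Function.update, and_comm]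

/-- The formula stating that configuration `1` is reached from configuration `0` in
`2 ^ (B * Fintype.card ι)` steps. -/
noncomputable def reach (B : ℕ) (g : LocalRule ι) : QBF (QVar ι) :=
  (cells ι B).foldr (fun _ φ => level B φ) (globalStep B g)

theorem sat_reach [NeZero B] {g : LocalRule ι} {e : QVar ι → Bool} : (reach B g).Sat e ↔
    config B e 1 = (globalMap B g)^[2 ^ (B * Fintype.card ι)] (config B e 0) := by
  rw [← length_cells, reach]
  induction cells ι B generalizing e with
  | nil => exact sat_globalStep
  | cons p l ih =>
    rw [List.foldr_cons, sat_level (R := fun x y => y = (globalMap B g)^[2 ^ l.length] x)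
      fun _ => ih]
    simp [pow_succ, mul_two, Function.iterate_add_apply]

open Classical in
/-- The formula stating that the content of cell `i` of configuration `1` satisfies `acc`. -/
noncomputable def cellAccepts (acc : (ι → Bool) → Prop) (i : ℕ) : QBF (QVar ι) :=
  ((Finset.univ : Finset (ι → Bool)).filter acc).toList.foldr (fun x φ => (cellIs 1 x i).or φ) ff

theorem sat_cellAccepts {acc : (ι → Bool) → Prop} {i : Fin B} {e : QVar ι → Bool} :
    (cellAccepts acc i).Sat e ↔ acc (config B e 1 i) := by
  simp [cellAccepts, sat_foldr_or, Sat, sat_cellIs]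

/-- The formula stating that all cells of configuration `1` satisfy `acc`. -/
noncomputable def final (B : ℕ) (acc : (ι → Bool) → Prop) : QBF (QVar ι) :=
  (List.range B).foldr (fun i φ => (cellAccepts acc i).and φ) tt

theorem sat_final {acc : (ι → Bool) → Prop} {e : QVar ι → Bool} :
    (final B acc).Sat e ↔ ∀ i, acc (config B e 1 i) := by
  simp only [final, sat_foldr_and, List.mem_range, Sat, and_true, ← sat_cellAccepts,
    Fin.forall_iff]

/-- The formula stating that all cells satisfy `acc` after `2 ^ (B * Fintype.card ι)` steps from the
configuration `x`. -/
noncomputable def accepts (B : ℕ) (g : LocalRule ι) (acc : (ι → Bool) → Prop) (x : ℕ → ι → Bool) :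
    QBF (QVar ι) :=
  exConfig B 0 (exConfig B 1 ((initial B x).and ((final B acc).and (reach B g))))

theorem sat_accepts [NeZero B] {g : LocalRule ι} {acc : (ι → Bool) → Prop} {x : ℕ → ι → Bool}
    {e : QVar ι → Bool} : (accepts B g acc x).Sat e ↔
      ∀ i, acc ((globalMap B g)^[2 ^ (B * Fintype.card ι)] (fun i : Fin B => x i) i) := by
  simp [accepts, Sat, sat_exConfig, sat_initial, sat_final, sat_reach, config_setConfig,
    Function.update]

end QBF

/-! ### Turing machines as cellular automata -/

theorem iterate_card_eq_of_isFixedPt {X : Type*} [Fintype X] {F : X → X} {x y : X}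
    (hy : F.IsFixedPt y) {t : ℕ} (ht : F^[t] x = y) : F^[Fintype.card X] x = y := by
  have hfix (k : ℕ) : F^[k] y = y := hy.iterate k
  obtain ⟨i, j, hij, heq⟩ : ∃ i j : Fin (Fintype.card X + 1), i < j ∧ F^[i] x = F^[j] x := by
    obtain ⟨i, j, hij, heq⟩ := Fintype.exists_ne_map_eq_of_card_lt
      (fun i : Fin (Fintype.card X + 1) => F^[i] x) (by simp)
    rcases hij.lt_or_gt with h | h
    exacts [⟨i, j, h, heq⟩, ⟨j, i, h, heq.symm⟩]
  have hpos : 0 < (j : ℕ) - i := Nat.sub_pos_of_lt hij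
  have hperiodic : F.IsPeriodicPt (j - i) (F^[i] x) := by
    rw [Function.IsPeriodicPt, Function.IsFixedPt, ← Function.iterate_add_apply,
      Nat.sub_add_cancel (Fin.le_of_lt hij), heq]
  have hi : F^[i] x = y := calc
    F^[i] x = F^[(j - i) * t] (F^[i] x) := (hperiodic.mul_const t).symm
    _ = F^[(j - i) * t - t + i] (F^[t] x) := by
      rw [← Function.iterate_add_apply, ← Function.iterate_add_apply, Nat.add_right_comm,
        Nat.sub_add_cancel (Nat.le_mul_of_pos_left t hpos)]
    _ = y := by rw [ht, hfix]
  rw [← Nat.sub_add_cancel (Nat.le_of_lt_succ i.isLt), Function.iterate_add_apply, hi, hfix]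

noncomputable instance : DecidableEq Move := Classical.decEq _

open Transducer (inputTape)

theorem inputTape_min_succ {α : Type} (w : List α) (i : ℕ) :
    inputTape w (min (i + 1) (w.length + 1)) = (w[i]?).elim .rightEnd .sym := by
  rcases Nat.lt_or_ge i w.length with h | h
  · rw [Nat.min_eq_left (by lia), inputTape]
  · rw [Nat.min_eq_right (by lia), inputTape, List.getElem?_eq_none le_rfl,
      List.getElem?_eq_none h]

/-- The initial contents of the cells of an automaton on input `w`: cell `i` is set up by `init`
from the input symbol number `i`, or the right end marker, and the truth value of `i = 0`. -/
def initialCells {α W : Type} (init : InputCell α → Bool → W) (w : List α) (i : ℕ) : W :=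
  init (inputTape w (min (i + 1) (w.length + 1))) (decide (i = 0))

namespace TM

variable {α : Type} (M : TM α)

/-- The content of a cell of a space-time diagram: the tape symbol, and the state of the machine if
the head is there. -/
abbrev Cell : Type := Option (α ⊕ M.Γ) × Option M.Q

variable {M}

/-- The instruction to be executed at a cell. -/
def action (x : M.Cell) : Option (M.Q × Option (α ⊕ M.Γ) × Move) := x.2.bind fun q => M.δ q x.1

/-- The new state of the machine if the head leaves the cell by the move `m`. -/
noncomputable def departure (x : M.Cell) (m : Move) : Option M.Q :=
  (action x).bind fun a => if a.2.2 = m then some a.1 else none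

/-- The local rule of the cellular automaton that simulates the machine; a halting configuration
is a fixed point. -/
noncomputable def rule (l c r : M.Cell) : M.Cell :=
  ((action c).elim c.1 fun a => a.2.1,
    if c.2.isSome then (action c).elim c.2 fun _ => departure c .stay
    else (departure l .right).or (departure r .left))

theorem departure_of_headless {x : M.Cell} (h : x.2 = none) (m : Move) : departure x m = none := by
  simp [departure, action, h]

theorem rule_congr {l l' c r r' : M.Cell} (hl : l = l' ∨ l.2 = none ∧ l'.2 = none)
    (hr : r = r' ∨ r.2 = none ∧ r'.2 = none) : rule l c r = rule l' c r' := by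
  have hdeparture {x x' : M.Cell} (h : x = x' ∨ x.2 = none ∧ x'.2 = none) (m : Move) :
      departure x m = departure x' m := by
    rcases h with rfl | ⟨h, h'⟩
    · rfl
    · rw [departure_of_headless h, departure_of_headless h']
  rw [rule, rule, hdeparture hl, hdeparture hr]

/-- The content of cell `z` of a configuration. -/
def view (c : M.Cfg) (z : ℤ) : M.Cell := (c.tape z, if z = c.head then some c.state else none)

theorem view_headless {c : M.Cfg} {z : ℤ} (h : z ≠ c.head) : (view c z).2 = none := by
  simp [view, h]

theorem rule_view_halted {c : M.Cfg} (h : M.step c = none) (z : ℤ) :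
    rule (view c (z - 1)) (view c z) (view c (z + 1)) = view c z := by
  have hδ : M.δ c.state (c.tape c.head) = none := by simpa [step] using h
  have haction (y : ℤ) : action (view c y) = none := by
    by_cases hy : y = c.head
    · subst hy; simp [action, view, hδ]
    · simp [action, view_headless hy]
  have hdeparture (y : ℤ) (m : Move) : departure (view c y) m = none := by
    rw [departure, haction, Option.bind_none]
  rw [rule, hdeparture, hdeparture, hdeparture, haction]
  by_cases hz : z = c.head <;> simp [view, hz]

theorem rule_view_step {c d : M.Cfg} (h : M.step c = some d) (z : ℤ) :
    rule (view c (z - 1)) (view c z) (view c (z + 1)) = view d z := by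
  simp only [step, Option.map_eq_some_iff] at h
  obtain ⟨⟨q, s, m⟩, hδ, rfl⟩ := h
  have hdeparture (y : ℤ) (m' : Move) :
      departure (view c y) m' = if y = c.head ∧ m = m' then some q else none := by
    by_cases hy : y = c.head
    · subst hy; simp [departure, action, view, hδ]
    · rw [departure_of_headless (view_headless hy), if_neg (by tauto)]
  rw [rule, hdeparture, hdeparture, hdeparture]
  by_cases hz : z = c.head
  · subst hz
    cases m <;> simp [view, action, hδ, Move.toInt]
  · have hleft : z - 1 = c.head ↔ z = c.head + 1 := by lia
    have hright : z + 1 = c.head ↔ z = c.head + -1 := by lia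
    have haction : action (view c z) = none := by simp [action, view_headless hz]
    rw [haction]
    cases m <;> simp [view, hz, Move.toInt, hleft, hright] <;> congr

/-- The integer in the window `-H, …, B - H - 1` that is represented by a cell of a cycle of
length `B`. -/
def rep (H : ℕ) {B : ℕ} (i : Fin B) : ℤ := if (i : ℕ) + H < B then i else (i : ℤ) - B

variable {H B : ℕ}

theorem rep_succ [NeZero B] (hH : 0 < H) (hB : H < B) (j : Fin B) :
    rep H (j + 1) = rep H j + 1 ∨ rep H j = B - H - 1 ∧ rep H (j + 1) = -H := by
  have hj := j.isLt
  have hsucc : ((j + 1 : Fin B) : ℕ) = (j + 1) % B := by simp [Fin.val_add]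
  simp only [rep, hsucc]
  rcases Nat.lt_or_ge ((j : ℕ) + 1) B with h | h
  · rw [Nat.mod_eq_of_lt h]; split_ifs <;> lia
  · rw [show (j : ℕ) + 1 = B by lia, Nat.mod_self]; split_ifs <;> lia

theorem exists_rep_eq (hB : H < B) {z : ℤ} (hl : -(H : ℤ) ≤ z) (hr : z < (B : ℤ) - H) :
    ∃ i : Fin B, rep H i = z := by
  rcases lt_or_ge z 0 with h | h
  · exact ⟨⟨(z + B).toNat, by lia⟩, by simp only [rep]; split_ifs <;> lia⟩
  · exact ⟨⟨z.toNat, by lia⟩, by simp only [rep]; split_ifs <;> lia⟩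

theorem globalMap_rule_view [NeZero B] (hH : 0 < H) (hB : H < B) {c : M.Cfg}
    (hl : -(H : ℤ) < c.head - 1) (hr : c.head + 1 < (B : ℤ) - H) (i : Fin B) :
    globalMap B rule (fun i => view c (rep H i)) i =
      rule (view c (rep H i - 1)) (view c (rep H i)) (view c (rep H i + 1)) := by
  have hpred := rep_succ (H := H) hH hB (i - 1)
  rw [sub_add_cancel] at hpred
  refine rule_congr (hpred.imp (fun h => ?_) fun h => ?_)
    ((rep_succ hH hB i).imp (fun h => ?_) fun h => ?_)
  · rw [h, add_sub_cancel_right]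
  · constructor <;> refine view_headless ?_ <;> lia
  · exact congrArg (view c) h
  · constructor <;> refine view_headless ?_ <;> lia

theorem exists_iterate_view [NeZero B] (hH : 0 < H) (hB : H < B) {c d : M.Cfg}
    (hr : M.Reaches c d)
    (hb : ∀ x, M.Reaches c x → -(H : ℤ) < x.head - 1 ∧ x.head + 1 < (B : ℤ) - H) :
    ∃ t, (globalMap B rule)^[t] (fun i => view c (rep H i)) = fun i => view d (rep H i) := by
  induction hr with
  | refl => exact ⟨0, rfl⟩
  | tail hr hs ih =>
    obtain ⟨t, ht⟩ := ih
    refine ⟨t + 1, ?_⟩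
    rw [Function.iterate_succ_apply', ht]
    funext i
    rw [globalMap_rule_view hH hB (hb _ hr).1 (hb _ hr).2, rule_view_step hs]

variable (M)

open Classical in
/-- The encoding of the content of a cell by bits. -/
noncomputable def bits (x : M.Cell) : M.Cell → Bool := fun y => decide (y = x)

theorem bits_injective : Function.Injective M.bits := by
  intro x y h
  simpa [bits] using congrFun h x

/-- The content of a cell with the given bits. -/
noncomputable def ofBits : (M.Cell → Bool) → M.Cell := Function.invFun M.bits

theorem ofBits_bits (x : M.Cell) : M.ofBits (M.bits x) = x :=
  Function.leftInverse_invFun M.bits_injective x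

/-- The local rule, acting on bits. -/
noncomputable def bitRule : LocalRule M.Cell :=
  fun l c r => M.bits (rule (M.ofBits l) (M.ofBits c) (M.ofBits r))

theorem semiconj_bits (B : ℕ) [NeZero B] :
    Function.Semiconj (fun (x : Fin B → M.Cell) i => M.bits (x i))
      (globalMap B rule) (globalMap B M.bitRule) := by
  intro x
  funext i
  simp only [globalMap, bitRule, ofBits_bits]

/-- If the cell contains a state, then that state is accepting iff `p` is true. -/
def cellAccepting (p : Bool) (x : M.Cell → Bool) : Prop :=
  ∀ q, (M.ofBits x).2 = some q → (q ∈ M.accepting ↔ p = true)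

theorem forall_cellAccepting_view (hB : H < B) {d : M.Cfg} (hl : -(H : ℤ) ≤ d.head)
    (hr : d.head < (B : ℤ) - H) (p : Bool) :
    (∀ i : Fin B, M.cellAccepting p (M.bits (view d (rep H i)))) ↔
      (d.state ∈ M.accepting ↔ p = true) := by
  simp only [cellAccepting, ofBits_bits]
  constructor
  · intro h
    obtain ⟨i, hi⟩ := exists_rep_eq hB hl hr
    exact h i d.state (by simp [view, hi])
  · intro h i q hq
    simp only [view] at hq
    split_ifs at hq
    rwa [← Option.some.inj hq]

/-- The tape symbol for a cell of a read-only input tape. -/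
def tapeSymbol : InputCell α → Option (α ⊕ M.Γ)
  | .sym a => some (.inl a)
  | _ => none

/-- The initial content of a cell that holds the given input; `atHead` tells whether the head is
there. -/
def initCell (x : InputCell α) (atHead : Bool) : M.Cell :=
  (M.tapeSymbol x, if atHead then some M.start else none)

/-- The bits of the initial content of a cell. -/
noncomputable def initBits (x : InputCell α) (atHead : Bool) : M.Cell → Bool :=
  M.bits (M.initCell x atHead)

theorem init_tape_rep (w : List α) (hw : w.length + H ≤ B) (i : Fin B) :
    (M.init w).tape (rep H i) = M.tapeSymbol (inputTape w (min (i + 1) (w.length + 1))) := by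
  have hi := i.isLt
  simp only [init]
  rw [inputTape_min_succ, rep]
  rcases Nat.lt_or_ge i w.length with h | h
  · rw [if_pos (by lia), if_pos (by lia), Int.toNat_natCast, List.getElem?_eq_getElem h]
    rfl
  · rw [List.getElem?_eq_none h]
    split_ifs
    · rw [Int.toNat_natCast, List.getElem?_eq_none h]; rfl
    · lia
    · lia
    · rfl

theorem view_init_rep (w : List α) (hw : w.length + H ≤ B) (hB : H < B) (i : Fin B) :
    view (M.init w) (rep H i) = initialCells M.initCell w i := by
  have hzero : rep H i = 0 ↔ (i : ℕ) = 0 := by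
    have hi := i.isLt
    simp only [rep]; split_ifs <;> lia
  refine Prod.ext (M.init_tape_rep w hw i) ?_
  simp only [view, initialCells, initCell, init, hzero, decide_eq_true_eq]

theorem forall_cellAccepting_iterate_initialCells [Fintype M.Cell] {X : Set (List α)} {s : ℕ → ℕ}
    (hM : M.DecidesInSpace X s) (p : Bool) (w : List α) [NeZero B]
    (hB : 2 * s w.length + w.length + 5 ≤ B) :
    (∀ i, M.cellAccepting p ((globalMap B M.bitRule)^[2 ^ (B * Fintype.card M.Cell)]
      (fun i : Fin B => initialCells M.initBits w i) i)) ↔ (w ∈ X ↔ p = true) := by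
  classical
  obtain ⟨hspace, d, hd, hhalt, haccept⟩ := hM w
  let H := s w.length + 2
  have hb (x) (hx : M.Reaches (M.init w) x) :
      -(H : ℤ) < x.head - 1 ∧ x.head + 1 < (B : ℤ) - H := by
    have := hspace x hx
    lia
  obtain ⟨hl, hr⟩ := hb d hd
  obtain ⟨t, ht⟩ := exists_iterate_view (by lia) (by lia) hd hb
  have hinit : (fun i : Fin B => initialCells M.initBits w i) =
      fun i => M.bits (view (M.init w) (rep H i)) := by
    funext i; rw [M.view_init_rep w (by lia) (by lia) i]; rfl
  have hreach : (globalMap B M.bitRule)^[t] (fun i => M.bits (view (M.init w) (rep H i))) =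
      fun i => M.bits (view d (rep H i)) := by
    rw [← ((M.semiconj_bits B).iterate_right t).eq fun i => view (M.init w) (rep H i), ht]
  have hfix : (globalMap B M.bitRule).IsFixedPt fun i => M.bits (view d (rep H i)) := by
    rw [Function.IsFixedPt, ← (M.semiconj_bits B).eq fun i => view d (rep H i)]
    funext i
    rw [globalMap_rule_view (by lia) (by lia) hl hr, rule_view_halted hhalt]
  have hcard : Fintype.card (Fin B → M.Cell → Bool) = 2 ^ (B * Fintype.card M.Cell) := by
    simp [← pow_mul, mul_comm]
  rw [hinit, ← hcard, iterate_card_eq_of_isFixedPt hfix hreach, ← haccept]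
  exact M.forall_cellAccepting_view (by lia) (by lia) (by lia) p

end TM

/-! ### From quantified Boolean formulas to first-order formulas -/

namespace Formula

variable {S : Signature}

/-- Conjunction, or disjunction if `p` is false. -/
def conn (p : Bool) (φ ψ : Formula S) : Formula S := if p then conj φ ψ else disj φ ψ

/-- Existential quantification, or universal quantification if `p` is false. -/
def quant (p : Bool) (i : ℕ) (φ : Formula S) : Formula S := if p then ex i φ else all i φ

/-- Truth of `φ`, or falsity if `p` is false. With `conn` and `quant` this treats a formula and its
dual at the same time. -/
def Holds (A : Model S) (p : Bool) (φ : Formula S) (e : ℕ → A.Carrier) : Prop :=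
  if p then φ.Sat A e else ¬ φ.Sat A e

variable {A : Model S} {p : Bool} {φ ψ : Formula S} {e : ℕ → A.Carrier} {i : ℕ}

theorem holds_conn : Holds A p (conn p φ ψ) e ↔ Holds A p φ e ∧ Holds A p ψ e := by
  cases p <;> simp [Holds, conn, Sat]

theorem holds_conn_not : Holds A p (conn (!p) φ ψ) e ↔ Holds A p φ e ∨ Holds A p ψ e := by
  cases p <;> simp [Holds, conn, Sat, imp_iff_not_or]

theorem holds_quant : Holds A p (quant p i φ) e ↔ ∃ a, Holds A p φ (Function.update e i a) := by
  cases p <;> simp [Holds, quant, Sat]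

theorem holds_quant_not : Holds A p (quant (!p) i φ) e ↔
    ∀ a, Holds A p φ (Function.update e i a) := by
  cases p <;> simp [Holds, quant, Sat]

section foldr

variable {X : Type*}

theorem holds_foldr_conn (l : List X) (F : X → Formula S) :
    Holds A p (l.foldr (fun x ψ => conn p (F x) ψ) φ) e ↔
      (∀ x ∈ l, Holds A p (F x) e) ∧ Holds A p φ e := by
  induction l with
  | nil => simp
  | cons x l ih => simp [holds_conn, ih, and_assoc]

theorem holds_foldr_conn_not (l : List X) (F : X → Formula S) :
    Holds A p (l.foldr (fun x ψ => conn (!p) (F x) ψ) φ) e ↔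
      (∃ x ∈ l, Holds A p (F x) e) ∨ Holds A p φ e := by
  induction l with
  | nil => simp
  | cons x l ih => simp [holds_conn_not, ih, or_assoc]

theorem holds_foldr_quant (l : List X) (v : X → ℕ) :
    Holds A p (l.foldr (fun x ψ => quant p (v x) ψ) φ) e ↔
      ∃ e', Set.EqOn e' e {y | ∃ x ∈ l, v x = y}ᶜ ∧ Holds A p φ e' :=
  foldr_exists_update_iff (fun _ _ _ => holds_quant) l v φ e

end foldr

section fragments

variable {L : Set Op}

theorem ops_conn_subset (hL : positiveOps ⊆ L) (hφ : φ.ops ⊆ L) (hψ : ψ.ops ⊆ L) :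
    (conn p φ ψ).ops ⊆ L := by
  cases p <;>
    exact Set.insert_subset (hL (by simp [positiveOps])) (Set.union_subset hφ hψ)

theorem ops_quant_subset (hL : positiveOps ⊆ L) (hφ : φ.ops ⊆ L) : (quant p i φ).ops ⊆ L := by
  cases p <;> exact Set.insert_subset (hL (by simp [positiveOps])) hφ

variable {s : Set ℕ}

theorem freeVars_conn_subset (hφ : φ.freeVars ⊆ s) (hψ : ψ.freeVars ⊆ s) :
    (conn p φ ψ).freeVars ⊆ s := by
  cases p <;> exact Set.union_subset hφ hψ

theorem freeVars_quant_subset (hφ : φ.freeVars ⊆ s) : (quant p i φ).freeVars ⊆ s := by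
  cases p <;> exact Set.sdiff_subset.trans hφ

end fragments

end Formula

namespace QBF

open Formula

variable {S : Signature} {V : Type}

/-- Translation to first-order logic, or to its dual if `p` is false, where `idx v` names the
variable `v` and the translations `lt`, `t` and `f` of literals, truth and falsity are given. -/
def toFormula (p : Bool) (idx : V → ℕ) (lt : Bool → ℕ → Formula S) (t f : Formula S) :
    QBF V → Formula S
  | tt => t
  | ff => f
  | lit b v => lt b (idx v)
  | and φ ψ => conn p (φ.toFormula p idx lt t f) (ψ.toFormula p idx lt t f)
  | or φ ψ => conn (!p) (φ.toFormula p idx lt t f) (ψ.toFormula p idx lt t f)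
  | ex v φ => quant p (idx v) (φ.toFormula p idx lt t f)
  | all v φ => quant (!p) (idx v) (φ.toFormula p idx lt t f)

/-- All literals are about variables in `q`. -/
def Within (q : Set V) : QBF V → Prop
  | tt | ff => True
  | lit _ v => v ∈ q
  | and φ ψ | or φ ψ => φ.Within q ∧ ψ.Within q
  | ex _ φ | all _ φ => φ.Within q

section semantics

variable {A : Model S} {p : Bool} {idx : V → ℕ} {lt : Bool → ℕ → Formula S} {t f : Formula S}
  {R : Bool → A.Carrier → Prop} {s : Set ℕ} {e e₀ : ℕ → A.Carrier} {β : V → Bool}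

theorem eqOn_update_idx (hs : ∀ v, idx v ∉ s) (he : Set.EqOn e e₀ s) (v : V) (a : A.Carrier) :
    Set.EqOn (Function.update e (idx v) a) e₀ s := fun i hi => by
  rw [Function.update_of_ne (ne_of_mem_of_not_mem hi (hs v)), he hi]

theorem rel_update_update [DecidableEq V] (hidx : Function.Injective idx)
    (hβ : ∀ v, R (β v) (e (idx v))) {v : V} {b : Bool} {a : A.Carrier} (hb : R b a) (w : V) :
    R (Function.update β v b w) (Function.update e (idx v) a (idx w)) := by
  obtain rfl | hw := eq_or_ne w v
  · rwa [Function.update_self, Function.update_self]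
  · rw [Function.update_of_ne hw, Function.update_of_ne (hidx.ne hw)]
    exact hβ w

theorem holds_toFormula_of_sat (hidx : Function.Injective idx) (hs : ∀ v, idx v ∉ s)
    (hR : Relator.BiTotal R)
    (hlt : ∀ e b v, Set.EqOn e e₀ s → R b (e (idx v)) → Holds A p (lt b (idx v)) e)
    (ht : ∀ e, Set.EqOn e e₀ s → Holds A p t e) {φ : QBF V} (he : Set.EqOn e e₀ s)
    (hβ : ∀ v, R (β v) (e (idx v))) (h : φ.Sat β) : Holds A p (φ.toFormula p idx lt t f) e := by
  classical
  induction φ generalizing β e with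
  | tt => exact ht e he
  | ff => exact h.elim
  | lit b v => exact hlt e b v he (h ▸ hβ v)
  | and φ ψ ihφ ihψ => exact holds_conn.2 ⟨ihφ he hβ h.1, ihψ he hβ h.2⟩
  | or φ ψ ihφ ihψ => exact holds_conn_not.2 (h.imp (ihφ he hβ) (ihψ he hβ))
  | ex v φ ih =>
    obtain ⟨b, hb⟩ := h
    obtain ⟨a, ha⟩ := hR.1 b
    refine holds_quant.2 ⟨a, ih (eqOn_update_idx hs he v a) (rel_update_update hidx hβ ha) ?_⟩
    convert hb
  | all v φ ih =>
    refine holds_quant_not.2 fun a => ?_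
    obtain ⟨b, hb⟩ := hR.2 a
    refine ih (eqOn_update_idx hs he v a) (rel_update_update hidx hβ hb) ?_
    convert h b

theorem sat_of_holds_toFormula (hidx : Function.Injective idx) (hs : ∀ v, idx v ∉ s)
    (hR : Relator.BiTotal R)
    (hlt : ∀ e b c v, Set.EqOn e e₀ s → R c (e (idx v)) → Holds A p (lt b (idx v)) e → c = b)
    (hf : ∀ e, Set.EqOn e e₀ s → ¬ Holds A p f e) {φ : QBF V} (he : Set.EqOn e e₀ s)
    (hβ : ∀ v, R (β v) (e (idx v))) (h : Holds A p (φ.toFormula p idx lt t f) e) : φ.Sat β := by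
  classical
  induction φ generalizing β e with
  | tt => trivial
  | ff => exact hf e he h
  | lit b v => exact hlt e b _ v he (hβ v) h
  | and φ ψ ihφ ihψ => exact (holds_conn.1 h).imp (ihφ he hβ) (ihψ he hβ)
  | or φ ψ ihφ ihψ => exact (holds_conn_not.1 h).imp (ihφ he hβ) (ihψ he hβ)
  | ex v φ ih =>
    obtain ⟨a, ha⟩ := holds_quant.1 h
    obtain ⟨b, hb⟩ := hR.2 a
    refine ⟨b, ?_⟩
    convert ih (eqOn_update_idx hs he v a) (rel_update_update hidx hβ hb) ha
  | all v φ ih =>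
    intro b
    obtain ⟨a, ha⟩ := hR.1 b
    convert ih (eqOn_update_idx hs he v a) (rel_update_update hidx hβ ha) (holds_quant_not.1 h a)

end semantics

section fragments

variable {p : Bool} {idx : V → ℕ} {lt : Bool → ℕ → Formula S} {t f : Formula S}

theorem ops_toFormula_subset {L : Set Op} (hL : positiveOps ⊆ L) (hlt : ∀ b i, (lt b i).ops ⊆ L)
    (ht : t.ops ⊆ L) (hf : f.ops ⊆ L) (φ : QBF V) : (φ.toFormula p idx lt t f).ops ⊆ L := by
  induction φ with
  | tt => exact ht
  | ff => exact hf
  | lit b v => exact hlt _ _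
  | and φ ψ ihφ ihψ | or φ ψ ihφ ihψ => exact ops_conn_subset hL ihφ ihψ
  | ex v φ ih | all v φ ih => exact ops_quant_subset hL ih

theorem freeVars_toFormula_subset {s : Set ℕ} {q : Set V}
    (hlt : ∀ b, ∀ v ∈ q, (lt b (idx v)).freeVars ⊆ s) (ht : t.freeVars ⊆ s) (hf : f.freeVars ⊆ s)
    {φ : QBF V} (hφ : φ.Within q) : (φ.toFormula p idx lt t f).freeVars ⊆ s := by
  induction φ with
  | tt => exact ht
  | ff => exact hf
  | lit b v => exact hlt _ _ hφ
  | and φ ψ ihφ ihψ | or φ ψ ihφ ihψ => exact freeVars_conn_subset (ihφ hφ.1) (ihψ hφ.2)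
  | ex v φ ih | all v φ ih => exact freeVars_quant_subset (ih hφ)

end fragments

end QBF

namespace Formula

variable {S : Signature}

/-- Renaming of all variables, free and bound. -/
def map (f : ℕ → ℕ) : Formula S → Formula S
  | rel R v => rel R (f ∘ v)
  | equal i j => equal (f i) (f j)
  | unequal i j => unequal (f i) (f j)
  | neg φ => neg (φ.map f)
  | conj φ ψ => conj (φ.map f) (ψ.map f)
  | disj φ ψ => disj (φ.map f) (ψ.map f)
  | ex i φ => ex (f i) (φ.map f)
  | all i φ => all (f i) (φ.map f)

/-- The bound variables of a formula. -/
def boundVars : Formula S → Set ℕ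
  | rel _ _ | equal _ _ | unequal _ _ => ∅
  | neg φ => φ.boundVars
  | conj φ ψ | disj φ ψ => φ.boundVars ∪ ψ.boundVars
  | ex i φ | all i φ => insert i φ.boundVars

theorem finite_boundVars (φ : Formula S) : φ.boundVars.Finite := by
  induction φ with
  | rel | equal | unequal => exact Set.finite_empty
  | neg _ ih => exact ih
  | conj φ ψ ihφ ihψ | disj φ ψ ihφ ihψ => exact ihφ.union ihψ
  | ex i φ ih | all i φ ih => exact ih.insert i

theorem ops_map (f : ℕ → ℕ) (φ : Formula S) : (φ.map f).ops = φ.ops := by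
  induction φ <;> simp_all [map, ops]

theorem freeVars_map_subset (f : ℕ → ℕ) (φ : Formula S) :
    (φ.map f).freeVars ⊆ f '' φ.freeVars := by
  induction φ with
  | rel R v => exact (Set.range_comp f v).subset
  | equal i j | unequal i j => exact Set.image_pair f i j |>.superset
  | neg _ ih => exact ih
  | conj φ ψ ihφ ihψ | disj φ ψ ihφ ihψ =>
    exact (Set.union_subset_union ihφ ihψ).trans (Set.image_union f _ _).superset
  | ex i φ ih | all i φ ih =>
    rintro _ ⟨hy, hi⟩
    obtain ⟨x, hx, rfl⟩ := ih hy
    exact ⟨x, ⟨hx, fun h => hi (congrArg f h)⟩, rfl⟩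

variable {A : Model S} {f : ℕ → ℕ}

theorem update_comp_of_forall_eq {X : Type*} {i : ℕ} (hi : ∀ y, f y = f i → y = i) (e : ℕ → X)
    (a : X) : Function.update e (f i) a ∘ f = Function.update (e ∘ f) i a := by
  funext y
  obtain rfl | hy := eq_or_ne y i
  · simp
  · simp [Function.update_of_ne hy, Function.update_of_ne fun h => hy (hi y h)]

theorem sat_map {φ : Formula S} (hf : ∀ x ∈ φ.boundVars, ∀ y, f y = f x → y = x)
    (e : ℕ → A.Carrier) : (φ.map f).Sat A e ↔ φ.Sat A (e ∘ f) := by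
  induction φ generalizing e with
  | rel R v => exact Iff.rfl
  | equal i j | unequal i j => exact Iff.rfl
  | neg φ ih => exact not_congr (ih hf e)
  | conj φ ψ ihφ ihψ =>
    exact and_congr (ihφ (fun x hx => hf x (.inl hx)) e) (ihψ (fun x hx => hf x (.inr hx)) e)
  | disj φ ψ ihφ ihψ =>
    exact or_congr (ihφ (fun x hx => hf x (.inl hx)) e) (ihψ (fun x hx => hf x (.inr hx)) e)
  | ex i φ ih =>
    refine exists_congr fun a => ?_
    rw [ih fun x hx => hf x (.inr hx), update_comp_of_forall_eq (hf i (.inl rfl))]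
  | all i φ ih =>
    refine forall_congr' fun a => ?_
    rw [ih fun x hx => hf x (.inr hx), update_comp_of_forall_eq (hf i (.inl rfl))]

/-- The renaming that puts `i` and `j` for the variables `0` and `1`. The other variables are moved
down so that they do not depend on `i` and `j`. -/
def instantiate (i j : ℕ) : ℕ → ℕ
  | 0 => i
  | 1 => j
  | n + 2 => n

/-- In `A`, the formula `φ`, or its negation if `p` is false, defines a nontrivial equivalence
relation between the values of the variables `0` and `1`. -/
def DefinesEquivalence (A : Model S) (p : Bool) (φ : Formula S) : Prop :=
  ∃ E : Setoid A.Carrier, (∃ x y, ¬ E x y) ∧ ∀ e, Holds A p φ e ↔ E (e 0) (e 1)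

end Formula

/-- Parameters of the translation of quantified Boolean formulas: a formula that is to define an
equivalence relation, its polarity, a bound on its bound variables and the number of names for
elements of the universe. -/
structure Frame (S : Signature) where
  θ : Formula S
  p : Bool
  r : ℕ
  N : ℕ
  freeVars_subset : θ.freeVars ⊆ {0, 1}
  boundVars_subset : θ.boundVars ⊆ Set.Icc 2 r

namespace Frame

open Formula

variable {S : Signature} (T : Frame S) {V : Type}

/-- The instance of the defining formula for the variables `i` and `j`. -/
def atom (i j : ℕ) : Formula S := T.θ.map (instantiate i j)

/-- The variable that stands for the truth value `b`. -/
def truth (b : Bool) : ℕ := T.r + b.toNat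

/-- The variable that names the `k`-th element. -/
def name (k : Fin T.N) : ℕ := T.r + 2 + k

/-- The first variable that has no fixed purpose. -/
def base : ℕ := T.r + 2 + T.N

theorem r_le_base : T.r ≤ T.base := by simp only [base]; lia

theorem truth_lt_base (b : Bool) : T.truth b < T.base := by
  have := Bool.toNat_le b
  simp only [truth, base]
  lia

theorem name_lt_base (k : Fin T.N) : T.name k < T.base := by simp [name, base]

theorem name_ne_truth (k : Fin T.N) (b : Bool) : T.name k ≠ T.truth b := by
  have := Bool.toNat_le b
  simp only [name, truth]
  lia

theorem name_injective : Function.Injective T.name := fun k l h => by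
  simp only [name] at h
  lia

/-- Element `i` counts as `b` if it is equivalent to the element that stands for `b` or to a named
element to which `I` assigns `b`. -/
def literal (I : Fin T.N → Bool) (b : Bool) (i : ℕ) : Formula S :=
  ((List.finRange T.N).filter fun k => I k = b).foldr
    (fun k φ => conn (!T.p) (T.atom i (T.name k)) φ) (T.atom i (T.truth b))

/-- The translation of a quantified Boolean formula under the assignment `I` to the names. -/
def translate (idx : V → ℕ) (I : Fin T.N → Bool) (φ : QBF V) : Formula S :=
  φ.toFormula T.p idx (T.literal I) (T.atom (T.truth false) (T.truth false))
    (T.atom (T.truth false) (T.truth true))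

/-- For all choices of two inequivalent elements that stand for the truth values, some elements can
be named such that the translation of `φ` is true under all assignments to the names. If all
elements are named, then every element counts as a truth value; the assignment that respects
equivalence to the element for `true` ensures that no element counts as both. -/
noncomputable def matrix (idx : V → ℕ) (φ : QBF V) : Formula S :=
  quant (!T.p) (T.truth false) (quant (!T.p) (T.truth true)
    (conn (!T.p) (T.atom (T.truth false) (T.truth true))
      ((List.finRange T.N).foldr (fun k ψ => quant T.p (T.name k) ψ)
        ((Finset.univ : Finset (Fin T.N → Bool)).toList.foldr
          (fun I ψ => conn T.p (T.translate idx I φ) ψ)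
          (T.atom (T.truth false) (T.truth false))))))

section fragments

variable {idx : V → ℕ} {φ : QBF V}

theorem ops_matrix_subset {L : Set Op} (hL : positiveOps ⊆ L) (hθ : T.θ.ops ⊆ L) :
    (T.matrix idx φ).ops ⊆ L := by
  have hatom (i j : ℕ) : (T.atom i j).ops ⊆ L := (ops_map _ _).trans_subset hθ
  have hliteral (I : Fin T.N → Bool) (b : Bool) (i : ℕ) : (T.literal I b i).ops ⊆ L :=
    List.foldrRecOn (motive := fun φ : Formula S => φ.ops ⊆ L) _ _ (hatom _ _) fun _ h _ _ =>
      ops_conn_subset hL (hatom _ _) h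
  refine ops_quant_subset hL (ops_quant_subset hL (ops_conn_subset hL (hatom _ _) ?_))
  refine List.foldrRecOn (motive := fun φ : Formula S => φ.ops ⊆ L) _ _ ?_ fun _ h _ _ =>
    ops_quant_subset hL h
  refine List.foldrRecOn (motive := fun φ : Formula S => φ.ops ⊆ L) _ _ (hatom _ _) fun _ h I _ =>
    ops_conn_subset hL ?_ h
  exact QBF.ops_toFormula_subset hL (hliteral I) (hatom _ _) (hatom _ _) φ

variable {s : Set ℕ}

theorem freeVars_atom_subset {i j : ℕ} (hi : i ∈ s) (hj : j ∈ s) : (T.atom i j).freeVars ⊆ s := by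
  refine (freeVars_map_subset _ _).trans ((Set.image_mono T.freeVars_subset).trans ?_)
  rw [Set.image_pair]
  exact Set.pair_subset hi hj

theorem freeVars_matrix_subset {q : Set V} (hs : ∀ i < T.base, i ∈ s) (hq : ∀ v ∈ q, idx v ∈ s)
    (hφ : φ.Within q) : (T.matrix idx φ).freeVars ⊆ s := by
  have htruth (b : Bool) : T.truth b ∈ s := hs _ (T.truth_lt_base b)
  have hname (k : Fin T.N) : T.name k ∈ s := hs _ (T.name_lt_base k)
  have hconst (b c : Bool) : (T.atom (T.truth b) (T.truth c)).freeVars ⊆ s :=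
    T.freeVars_atom_subset (htruth b) (htruth c)
  have hliteral (I : Fin T.N → Bool) (b : Bool) (v : V) (hv : v ∈ q) :
      (T.literal I b (idx v)).freeVars ⊆ s :=
    List.foldrRecOn (motive := fun φ : Formula S => φ.freeVars ⊆ s) _ _
      (T.freeVars_atom_subset (hq v hv) (htruth b)) fun _ h _ _ =>
        freeVars_conn_subset (T.freeVars_atom_subset (hq v hv) (hname _)) h
  refine freeVars_quant_subset (freeVars_quant_subset (freeVars_conn_subset (hconst _ _) ?_))
  refine List.foldrRecOn (motive := fun φ : Formula S => φ.freeVars ⊆ s) _ _ ?_ fun _ h _ _ =>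
    freeVars_quant_subset h
  refine List.foldrRecOn (motive := fun φ : Formula S => φ.freeVars ⊆ s) _ _ (hconst _ _)
    fun _ h I _ => freeVars_conn_subset ?_ h
  exact QBF.freeVars_toFormula_subset (hliteral I) (hconst _ _) (hconst _ _) hφ

end fragments

section semantics

variable {T} {A : Model S} {E : Setoid A.Carrier}
  (hE : ∀ e, Holds A T.p T.θ e ↔ E (e 0) (e 1))

include hE

theorem holds_atom {i j : ℕ} (hi : T.r ≤ i) (hj : T.r ≤ j) (e : ℕ → A.Carrier) :
    Holds A T.p (T.atom i j) e ↔ E (e i) (e j) := by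
  have hinst : ∀ x ∈ T.θ.boundVars, ∀ y, instantiate i j y = instantiate i j x → y = x := by
    intro x hx y h
    obtain ⟨h2, hr⟩ := T.boundVars_subset hx
    match x, y with
    | x + 2, 0 | x + 2, 1 | x + 2, y + 2 => simp only [instantiate] at h; lia
  rw [atom, Holds, sat_map hinst]
  exact hE _

theorem holds_literal {i : ℕ} (hi : T.r ≤ i) (I : Fin T.N → Bool) (b : Bool) (e : ℕ → A.Carrier) :
    Holds A T.p (T.literal I b i) e ↔
      (∃ k, I k = b ∧ E (e i) (e (T.name k))) ∨ E (e i) (e (T.truth b)) := by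
  have hname (k : Fin T.N) : T.r ≤ T.name k := by simp only [name]; lia
  rw [literal, holds_foldr_conn_not]
  simp [holds_atom hE hi (hname _), holds_atom hE hi (Nat.le_add_right T.r _), truth]

theorem holds_atom_truth (b c : Bool) (e : ℕ → A.Carrier) :
    Holds A T.p (T.atom (T.truth b) (T.truth c)) e ↔ E (e (T.truth b)) (e (T.truth c)) :=
  holds_atom hE (Nat.le_add_right _ _) (Nat.le_add_right _ _) e

variable {idx : V → ℕ} (hidx : Function.Injective idx) (hbase : ∀ v, T.base ≤ idx v)
  {φ : QBF V} {e₀ : ℕ → A.Carrier}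

include hidx hbase

theorem exists_sat_of_holds_translate (hne : ¬ E (e₀ (T.truth false)) (e₀ (T.truth true)))
    (h : ∀ I, Holds A T.p (T.translate idx I φ) e₀) : ∃ β, φ.Sat β := by
  classical
  let value (a : A.Carrier) : Bool := decide (E a (e₀ (T.truth true)))
  have value_congr {a c : A.Carrier} (hac : E a c) : value a = value c :=
    decide_eq_decide.2 ⟨E.trans (E.symm hac), E.trans hac⟩
  have value_truth (b : Bool) : value (e₀ (T.truth b)) = b := by
    cases b
    exacts [decide_eq_false hne, decide_eq_true (E.refl _)]
  refine ⟨fun v => value (e₀ (idx v)), QBF.sat_of_holds_toFormula (R := fun b a => value a = b)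
    (s := Set.Iio T.base) hidx (fun v => not_lt.2 (hbase v))
    ⟨fun b => ⟨_, value_truth b⟩, fun a => ⟨_, rfl⟩⟩ (fun e b c v he hc hl => ?_)
    (fun e he hf => ?_) (Set.eqOn_refl _ _) (fun _ => rfl) (h fun k => value (e₀ (T.name k)))⟩
  · rw [holds_literal hE (T.r_le_base.trans (hbase v)),
      he (T.truth_lt_base b)] at hl
    rw [← hc]
    rcases hl with ⟨k, hk, hv⟩ | hv
    · rw [he (T.name_lt_base k)] at hv
      rw [value_congr hv, hk]
    · rw [value_congr hv, value_truth]
  · rw [holds_atom_truth hE, he (T.truth_lt_base _), he (T.truth_lt_base _)] at hf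
    exact hne hf

theorem holds_translate_of_forall_sat (hname : ∀ a, ∃ k, e₀ (T.name k) = a) (hφ : ∀ β, φ.Sat β)
    (I : Fin T.N → Bool) : Holds A T.p (T.translate idx I φ) e₀ := by
  let R (b : Bool) (a : A.Carrier) : Prop :=
    (∃ k, I k = b ∧ a = e₀ (T.name k)) ∨ a = e₀ (T.truth b)
  have htotal (a : A.Carrier) : ∃ b, R b a := by
    obtain ⟨k, rfl⟩ := hname a
    exact ⟨I k, .inl ⟨k, rfl, rfl⟩⟩
  choose value hvalue using htotal
  refine QBF.holds_toFormula_of_sat (s := Set.Iio T.base) hidx (fun v => not_lt.2 (hbase v))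
    (R := R) ⟨fun b => ⟨_, .inr rfl⟩, fun a => ⟨value a, hvalue a⟩⟩ (fun e b v he hb => ?_)
    (fun e _ => (holds_atom_truth hE _ _ e).2 (E.refl _)) (Set.eqOn_refl _ _)
    (fun v => hvalue (e₀ (idx v))) (hφ _)
  rw [holds_literal hE (T.r_le_base.trans (hbase v))]
  rcases hb with ⟨k, hk, hv⟩ | hv
  · exact .inl ⟨k, hk, by rw [hv, he (T.name_lt_base k)]⟩
  · exact .inr (by rw [hv, he (T.truth_lt_base b)])

omit hidx hbase in
theorem holds_matrix_iff {e : ℕ → A.Carrier} : Holds A T.p (T.matrix idx φ) e ↔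
    ∀ x y, E x y ∨ ∃ e₀ : ℕ → A.Carrier,
      Set.EqOn e₀ (Function.update (Function.update e (T.truth false) x) (T.truth true) y)
        (Set.range T.name)ᶜ ∧ ∀ I, Holds A T.p (T.translate idx I φ) e₀ := by
  have hne : T.truth false ≠ T.truth true := by simp [truth]
  simp only [matrix, holds_quant_not, holds_conn_not, holds_foldr_quant, holds_foldr_conn,
    holds_atom_truth hE, Finset.mem_toList, Finset.mem_univ, true_imp_iff, List.mem_finRange,
    true_and, Function.update_self, Function.update_of_ne hne, Setoid.refl, and_true]
  exact Iff.rfl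

theorem holds_matrix (hne : ∃ x y, ¬ E x y) (hN : Nat.card A.Carrier ≤ T.N) {P : Prop}
    (hφ : ∀ β, φ.Sat β ↔ P) (e : ℕ → A.Carrier) : Holds A T.p (T.matrix idx φ) e ↔ P := by
  have hname (b : Bool) : T.truth b ∈ (Set.range T.name)ᶜ := fun ⟨k, hk⟩ => T.name_ne_truth k b hk
  have htruth : T.truth false ≠ T.truth true := by simp [truth]
  rw [holds_matrix_iff hE]
  constructor
  · intro h
    obtain ⟨x, y, hxy⟩ := hne
    obtain ⟨e₀, he₀, hsat⟩ := (h x y).resolve_left hxy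
    have htruth_ne : ¬ E (e₀ (T.truth false)) (e₀ (T.truth true)) := by
      rwa [he₀ (hname _), he₀ (hname _), Function.update_self, Function.update_of_ne htruth,
        Function.update_self]
    obtain ⟨β, hβ⟩ := exists_sat_of_holds_translate hE hidx hbase htruth_ne hsat
    exact (hφ β).1 hβ
  · intro hP x y
    have := A.finite
    have := Fintype.ofFinite A.Carrier
    obtain ⟨c, hc⟩ : ∃ c : Fin T.N → A.Carrier, Function.Surjective c :=
      Function.exists_surjective_iff.2 ⟨⟨fun _ => x⟩,
        Function.Embedding.nonempty_of_card_le (by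
          rwa [Fintype.card_fin, ← Nat.card_eq_fintype_card])⟩
    refine .inr ⟨Function.extend T.name c _, fun i hi => Function.extend_apply' _ _ i hi, ?_⟩
    refine holds_translate_of_forall_sat hE hidx hbase (fun a => ?_) fun β => (hφ β).2 hP
    obtain ⟨k, rfl⟩ := hc a
    exact ⟨k, T.name_injective.extend_apply _ _ k⟩

end semantics

end Frame

namespace Formula

variable {S : Signature}

/-- Universal quantification over the variables in a list. -/
def closure (l : List ℕ) (φ : Formula S) : Formula S := l.foldr all φ

theorem sat_closure {A : Model S} (l : List ℕ) (φ : Formula S) (e : ℕ → A.Carrier) :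
    (closure l φ).Sat A e ↔ ∀ e', Set.EqOn e' e {y | y ∈ l}ᶜ → φ.Sat A e' := by
  have h := holds_foldr_quant (p := false) (φ := φ) (e := e) l id
  simp only [Holds, quant, id, exists_eq_right, Bool.false_eq_true, if_false] at h
  rw [closure, ← not_iff_not, h]
  push Not
  rfl

theorem freeVars_closure (l : List ℕ) (φ : Formula S) :
    (closure l φ).freeVars = φ.freeVars \ {y | y ∈ l} := by
  induction l with
  | nil => simp [closure]
  | cons i l ih =>
    change (closure l φ).freeVars \ {i} = _
    rw [ih, Set.sdiff_sdiff]
    congr 1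
    ext y
    simp

theorem ops_closure_subset {L : Set Op} (hL : positiveOps ⊆ L) {φ : Formula S} (hφ : φ.ops ⊆ L)
    (l : List ℕ) : (closure l φ).ops ⊆ L :=
  List.foldrRecOn (motive := fun φ : Formula S => φ.ops ⊆ L) l _ hφ fun _ h _ _ =>
    Set.insert_subset (hL (by simp [positiveOps])) h

end Formula

namespace Frame

variable {S : Signature} (T : Frame S) (ι : Type) [Fintype ι]

/-- The number of variables that are provided for each cell. They include all variables below
`T.base`, so that there are enough of these even for one cell. -/
noncomputable def width : ℕ := T.base + Fintype.card (Kind ι)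

/-- All variables that are provided for `B` cells. -/
noncomputable def allVars (B : ℕ) : List ℕ :=
  (List.range B).flatMap fun i => (List.range (T.width ι)).map fun c => i * T.width ι + c

variable {ι}

/-- The number of a kind of variables among those provided for a cell. -/
noncomputable def offset (κ : Kind ι) : ℕ := T.base + Fintype.equivFin (Kind ι) κ

/-- The variables of quantified Boolean formulas as variables of first-order logic. -/
noncomputable def index (v : QVar ι) : ℕ := v.2 * T.width ι + T.offset v.1

theorem offset_lt_width (κ : Kind ι) : T.offset κ < T.width ι :=
  Nat.add_lt_add_left (Fintype.equivFin (Kind ι) κ).isLt _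

theorem index_injective : Function.Injective (T.index : QVar ι → ℕ) := by
  rintro ⟨κ, i⟩ ⟨κ', i'⟩ h
  have hκ := T.offset_lt_width κ
  have hκ' := T.offset_lt_width κ'
  have hi : i = i' := by
    have := congrArg (· / T.width ι) h
    simpa [index, add_comm (_ * _), Nat.add_mul_div_right _ _ (pos_of_gt hκ),
      Nat.div_eq_of_lt hκ, Nat.div_eq_of_lt hκ'] using this
  subst hi
  simpa [index, offset, Fin.val_inj] using h

theorem base_le_index (v : QVar ι) : T.base ≤ T.index v := by
  simp only [index, offset]; lia

variable {B : ℕ}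

theorem index_lt {v : QVar ι} (h : v.2 < B) : T.index v < B * T.width ι :=
  calc T.index v < v.2 * T.width ι + T.width ι := Nat.add_lt_add_left (T.offset_lt_width v.1) _
    _ = (v.2 + 1) * T.width ι := by ring
    _ ≤ B * T.width ι := Nat.mul_le_mul_right _ h

theorem base_le_mul_width (hB : 0 < B) : T.base ≤ B * T.width ι :=
  (Nat.le_add_right _ _).trans (Nat.le_mul_of_pos_left _ hB)

theorem mem_allVars {n : ℕ} (h : n < B * T.width ι) : n ∈ T.allVars ι B := by
  have hpos : 0 < T.width ι := Nat.pos_of_ne_zero fun h0 => by simp [h0] at h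
  simp only [allVars, List.mem_flatMap, List.mem_range, List.mem_map]
  exact ⟨n / T.width ι, (Nat.div_lt_iff_lt_mul hpos).2 h, n % T.width ι, Nat.mod_lt _ hpos,
    Nat.div_add_mod' n _⟩

/-- The sentence that expresses `φ`, a quantified Boolean formula about `B` cells. -/
noncomputable def sentence (B : ℕ) (φ : QBF (QVar ι)) : Formula S :=
  Formula.closure (T.allVars ι B) (T.matrix T.index φ)

theorem isSentence_sentence (hB : 0 < B) {L : Set Op} (hL : positiveOps ⊆ L) (hθ : T.θ.ops ⊆ L)
    {φ : QBF (QVar ι)} (hφ : φ.Within {v | v.2 < B}) : (T.sentence B φ).IsSentence L := by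
  refine ⟨?_, Formula.ops_closure_subset hL (T.ops_matrix_subset hL hθ) _⟩
  rw [sentence, Formula.freeVars_closure, Set.sdiff_eq_empty]
  exact T.freeVars_matrix_subset (fun i hi => T.mem_allVars (hi.trans_le (T.base_le_mul_width hB)))
    (fun v hv => T.mem_allVars (T.index_lt hv)) hφ

theorem models_sentence {A : Model S} {E : Setoid A.Carrier}
    (hE : ∀ e, Formula.Holds A T.p T.θ e ↔ E (e 0) (e 1)) (hne : ∃ x y, ¬ E x y)
    (hN : Nat.card A.Carrier ≤ T.N) {φ : QBF (QVar ι)} {P : Prop}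
    (hφ : ∀ β, φ.Sat β ↔ (P ↔ T.p = true)) (B : ℕ) : Models A (T.sentence B φ) ↔ P := by
  have hsat (e : ℕ → A.Carrier) : (T.matrix T.index φ).Sat A e ↔ P := by
    have := holds_matrix hE T.index_injective T.base_le_index hne hN hφ e
    cases hp : T.p <;> simpa [Formula.Holds, hp, not_iff_not] using this
  have := A.nontrivial.to_nonempty
  simp only [Models, sentence, Formula.sat_closure, hsat]
  exact ⟨fun h => h (Classical.arbitrary _) _ (Set.eqOn_refl _ _), fun h _ _ _ => h⟩

end Frame

namespace QBF

open QVar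

section foldr

variable {V X : Type} {q : Set V}

theorem within_foldr (l : List X) {F : X → QBF V → QBF V} {φ : QBF V}
    (hF : ∀ x ∈ l, ∀ ψ, ψ.Within q → (F x ψ).Within q) (hφ : φ.Within q) :
    (l.foldr F φ).Within q :=
  List.foldrRecOn (motive := (Within q ·)) l F hφ fun ψ hψ x hx => hF x hx ψ hψ

end foldr

variable {ι : Type} [Fintype ι] {B : ℕ}

theorem within_exConfig (a : Fin 5) {φ : QBF (QVar ι)} (hφ : φ.Within {v | v.2 < B}) :
    (exConfig B a φ).Within {v | v.2 < B} :=
  within_foldr _ (fun _ _ _ h => h) hφ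

theorem within_sameConfig (a c : Fin 5) :
    (sameConfig B a c : QBF (QVar ι)).Within {v | v.2 < B} := by
  refine within_foldr _ (fun p hp ψ h => ⟨?_, h⟩) trivial
  have : p.1 < B := mem_cells.1 hp
  simp [same, Within, bit, this]

theorem within_level (hB : 0 < B) {φ : QBF (QVar ι)} (hφ : φ.Within {v | v.2 < B}) :
    (level B φ).Within {v | v.2 < B} := by
  have hsame (a c : Fin 5) := within_sameConfig (ι := ι) (B := B) a c
  have hselect : (selectHalf B : QBF (QVar ι)).Within {v | v.2 < B} :=
    ⟨⟨hB, hsame _ _, hsame _ _⟩, hB, hsame _ _, hsame _ _⟩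
  have hrelocate : (relocate B φ).Within {v | v.2 < B} :=
    within_exConfig 0 (within_exConfig 1 ⟨hsame _ _, hsame _ _, hφ⟩)
  exact within_exConfig 2 (within_exConfig 3 (within_exConfig 4 ⟨hselect, hrelocate⟩))

theorem within_cellIs (a : Fin 5) (x : ι → Bool) {i : ℕ} (hi : i < B) :
    (cellIs a x i).Within {v | v.2 < B} :=
  within_foldr _ (fun _ _ _ h => ⟨hi, h⟩) trivial

theorem within_globalStep (hB : 0 < B) (g : LocalRule ι) :
    (globalStep B g).Within {v | v.2 < B} := by
  have hmod (i : ℕ) : i % B < B := Nat.mod_lt i hB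
  exact within_foldr _ (fun i hi _ h => ⟨within_foldr _ (fun x _ _ h =>
    ⟨⟨within_cellIs _ _ (List.mem_range.1 hi), within_cellIs _ _ (hmod _),
      within_cellIs _ _ (hmod _), within_cellIs _ _ (hmod _)⟩, h⟩) trivial, h⟩) trivial

theorem within_accepts (hB : 0 < B) (g : LocalRule ι) (acc : (ι → Bool) → Prop)
    (x : ℕ → ι → Bool) : (accepts B g acc x).Within {v | v.2 < B} := by
  have hinitial : (initial B x).Within {v | v.2 < B} :=
    within_foldr _ (fun i hi _ h => ⟨within_cellIs _ _ (List.mem_range.1 hi), h⟩) trivial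
  have hfinal : (final B acc).Within {v | v.2 < B} :=
    within_foldr _ (fun i hi _ h => ⟨within_foldr _ (fun _ _ _ h =>
      ⟨within_cellIs _ _ (List.mem_range.1 hi), h⟩) trivial, h⟩) trivial
  have hreach : (reach B g).Within {v | v.2 < B} :=
    within_foldr _ (fun _ _ _ h => within_level hB h) (within_globalStep hB g)
  exact within_exConfig 0 (within_exConfig 1 ⟨hinitial, hfinal, hreach⟩)

end QBF

/-! ### The text of the sentences -/

/-- Emission of the text of an object that depends on the input and on the counters. -/
def EmitsText {α β : Type} {K : ℕ} {Φ : Type*} (b : ℕ) [NeZero b] (m : ℕ) (P : ℕ → Prop)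
    (text : Φ → List β) (φ : List α → ℕ → ℕ → (Fin K → ℕ) → Φ) : Prop :=
  Emits b m P fun w L h σ => text (φ w L h σ)

/-- Emission of what an operation puts in front of the text of its argument. -/
def EmitsPrefix {α β : Type} {K : ℕ} {Φ : Type*} (b : ℕ) [NeZero b] (m : ℕ) (P : ℕ → Prop)
    (text : Φ → List β) (F : List α → ℕ → ℕ → (Fin K → ℕ) → Φ → Φ) : Prop :=
  ∃ pre : Emission α β K, Emits b m P pre ∧
    ∀ w L h σ φ, text (F w L h σ φ) = pre w L h σ ++ text φ

section text

variable {α β : Type} {K b : ℕ} [NeZero b] {m : ℕ} {P : ℕ → Prop} {Φ : Type*}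
  {text : Φ → List β} {F G : List α → ℕ → ℕ → (Fin K → ℕ) → Φ → Φ}
  {φ : List α → ℕ → ℕ → (Fin K → ℕ) → Φ}

theorem text_foldr {X : Type*} {l : List X} {op : X → Φ → Φ} {pre : X → List β}
    (h : ∀ x ψ, text (op x ψ) = pre x ++ text ψ) (ψ : Φ) :
    text (l.foldr op ψ) = l.flatMap pre ++ text ψ := by
  induction l with
  | nil => rfl
  | cons x l ih => simp [h, ih]

theorem EmitsText.const (φ : Φ) :
    EmitsText b m P text (fun _ _ _ _ => φ : List α → ℕ → ℕ → (Fin K → ℕ) → Φ) :=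
  Emits.const (text φ)

namespace EmitsPrefix

theorem emitsText (hF : EmitsPrefix b m P text F) (hφ : EmitsText b m P text φ) :
    EmitsText b m P text fun w L h σ => F w L h σ (φ w L h σ) := by
  obtain ⟨pre, hpre, hF⟩ := hF
  exact (hpre.append hφ).congr fun w L h σ _ _ _ => hF w L h σ _

theorem comp (hF : EmitsPrefix b m P text F) (hG : EmitsPrefix b m P text G) :
    EmitsPrefix b m P text fun w L h σ φ => F w L h σ (G w L h σ φ) := by
  obtain ⟨pre, hpre, hF⟩ := hF
  obtain ⟨pre', hpre', hG⟩ := hG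
  exact ⟨_, hpre.append hpre', fun w L h σ φ => by rw [hF, hG, List.append_assoc]⟩

theorem of_semiconj {Ψ : Type*} {g : Φ → Ψ} {text : Ψ → List β}
    {G : List α → ℕ → ℕ → (Fin K → ℕ) → Ψ → Ψ} (hG : EmitsPrefix b m P text G)
    (h : ∀ w L h σ, Function.Semiconj g (F w L h σ) (G w L h σ)) :
    EmitsPrefix b m P (fun φ => text (g φ)) F := by
  obtain ⟨pre, hpre, hG⟩ := hG
  exact ⟨pre, hpre, fun w L k σ φ => (congrArg text (h w L k σ φ)).trans (hG w L k σ _)⟩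

theorem foldr {X : Type*} (l : List X) {F : X → List α → ℕ → ℕ → (Fin K → ℕ) → Φ → Φ}
    (hF : ∀ x, EmitsPrefix b m P text (F x)) :
    EmitsPrefix b m P text fun w L h σ φ => l.foldr (fun x => F x w L h σ) φ := by
  choose pre hpre hF using hF
  exact ⟨_, Emits.flatMap l hpre, fun w L h σ φ => text_foldr (fun x ψ => hF x w L h σ ψ) φ⟩

theorem range (hm : m < K) {F : ℕ → ℕ → Φ → Φ}
    (hF : EmitsPrefix b (m + 1) P text
      (fun _ L _ σ => F L (σ ⟨m, hm⟩) : List α → ℕ → ℕ → (Fin K → ℕ) → Φ → Φ)) :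
    EmitsPrefix b m P text (fun _ L _ _ φ => (List.range (b ^ L)).foldr (F L) φ :
      List α → ℕ → ℕ → (Fin K → ℕ) → Φ → Φ) := by
  obtain ⟨pre, hpre, hF⟩ := hF
  refine ⟨_, Emits.range hm hpre, fun w L h σ φ => text_foldr (fun i ψ => ?_) φ⟩
  simpa only [Function.update_self] using hF w L h (Function.update σ ⟨m, hm⟩ i) ψ

theorem range_flatMap_map (hm : m < K) {X Y : Type*} (l : List X) (u : ℕ → X → Y)
    {F : ℕ → Y → Φ → Φ} (hF : ∀ x, EmitsPrefix b (m + 1) P text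
      (fun _ L _ σ => F L (u (σ ⟨m, hm⟩) x) : List α → ℕ → ℕ → (Fin K → ℕ) → Φ → Φ)) :
    EmitsPrefix b m P text (fun _ L _ _ φ =>
      ((List.range (b ^ L)).flatMap fun i => l.map (u i)).foldr (F L) φ :
        List α → ℕ → ℕ → (Fin K → ℕ) → Φ → Φ) := by
  simp only [List.foldr_flatMap, List.foldr_map]
  exact range hm (foldr l hF)

theorem rangeInput [Finite α] (hm : m < K) {F : InputCell α → ℕ → Φ → Φ}
    (hF : ∀ x, EmitsPrefix b (m + 1) (fun _ => True) text
      (fun _ _ _ σ => F x (σ ⟨m, hm⟩) : List α → ℕ → ℕ → (Fin K → ℕ) → Φ → Φ)) :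
    EmitsPrefix b m (fun h => h = 0) text (fun w L _ _ φ => (List.range (b ^ L)).foldr
      (fun i => F (Transducer.inputTape w (min (i + 1) (w.length + 1))) i) φ :
        List α → ℕ → ℕ → (Fin K → ℕ) → Φ → Φ) := by
  choose pre hpre hF using hF
  refine ⟨_, Emits.rangeInput hm (Emits.input hpre), fun w L _ σ φ =>
    text_foldr (fun i ψ => ?_) φ⟩
  simpa only [Function.update_self] using hF _ w L _ (Function.update σ ⟨m, hm⟩ i) ψ

end EmitsPrefix

end text

/-- The token of `Formula.conn p`. -/
def connToken (p : Bool) : Token := if p then .conj else .disj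

/-- The token of `Formula.quant p`. -/
def quantToken (p : Bool) : Token := if p then .ex else .all

section formulas

variable {S : Signature} {code : S.Symbol → List Bool} {α : Type} {K b : ℕ} [NeZero b] {m : ℕ}
  {P : ℕ → Prop}

theorem encode_conn (p : Bool) (φ ψ : Formula S) : encode code (Formula.conn p φ ψ) =
    [connToken p] ++ (encode code φ ++ encode code ψ) := by
  cases p <;> rfl

theorem encode_quant (p : Bool) (i : ℕ) (φ : Formula S) : encode code (Formula.quant p i φ) =
    [quantToken p] ++ (encodeVar i ++ encode code φ) := by
  cases p <;> rfl

theorem emits_encodeVar (hm : m < K) {i : Fin K} (hi : i < m) (W c : ℕ) :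
    Emits b m P (fun _ _ _ σ => encodeVar (σ i * W + c) : Emission α Token K) := by
  refine ((Emits.const [Token.var]).append
    ((Emits.replicate_counter hm i hi (List.replicate W Token.tick)).append
      (Emits.const (List.replicate c Token.tick)))).congr fun w L h σ _ _ _ => ?_
  rw [encodeVar, List.replicate_add, List.flatten_replicate_replicate, List.singleton_append]

theorem emits_encode_map {f : ℕ → (Fin K → ℕ) → ℕ}
    (hf : ∀ x, Emits b m P (fun _ _ _ σ => encodeVar (f x σ) : Emission α Token K))
    (θ : Formula S) :
    Emits b m P (fun _ _ _ σ => encode code (θ.map (f · σ)) : Emission α Token K) := by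
  induction θ with
  | rel R v =>
    have hargs := Emits.flatMap (List.ofFn v) hf
    refine ((Emits.const (.rel :: (code R).map .bit)).append hargs).congr fun w L h σ _ _ _ => ?_
    simp only [Formula.map, encode, List.flatMap_def, List.map_ofFn]
    rfl
  | equal i j | unequal i j => exact (Emits.const [_]).append ((hf i).append (hf j))
  | neg _ ih => exact (Emits.const [_]).append ih
  | conj _ _ ihφ ihψ | disj _ _ ihφ ihψ => exact (Emits.const [_]).append (ihφ.append ihψ)
  | ex i _ ih | all i _ ih => exact (Emits.const [_]).append ((hf i).append ih)

theorem emitsPrefix_conn (p : Bool) {φ : List α → ℕ → ℕ → (Fin K → ℕ) → Formula S}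
    (hφ : EmitsText b m P (encode code) φ) :
    EmitsPrefix b m P (encode code) fun w L h σ => Formula.conn p (φ w L h σ) :=
  ⟨_, (Emits.const [connToken p]).append hφ, fun _ _ _ _ _ => by
    rw [encode_conn, List.append_assoc]⟩

theorem emitsPrefix_quant (p : Bool) {v : List α → ℕ → ℕ → (Fin K → ℕ) → ℕ}
    (hv : EmitsText b m P encodeVar v) :
    EmitsPrefix b m P (encode code) fun w L h σ => Formula.quant p (v w L h σ) :=
  ⟨_, (Emits.const [quantToken p]).append hv, fun _ _ _ _ _ => by
    rw [encode_quant, List.append_assoc]⟩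

end formulas

namespace Frame

variable {S : Signature} {code : S.Symbol → List Bool} {T : Frame S} {α ι : Type} [Fintype ι]
  {K b : ℕ} [NeZero b] {m : ℕ} {P : ℕ → Prop}

theorem emits_atom {v : (Fin K → ℕ) → ℕ}
    (hv : Emits b m P (fun _ _ _ σ => encodeVar (v σ) : Emission α Token K)) (j : ℕ) :
    EmitsText b m P (encode code)
      (fun _ _ _ σ => T.atom (v σ) j : List α → ℕ → ℕ → (Fin K → ℕ) → Formula S) := by
  refine emits_encode_map (f := fun x σ => Formula.instantiate (v σ) j x) (fun x => ?_) T.θ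
  match x with
  | 0 => exact hv
  | 1 => exact Emits.const (encodeVar j)
  | n + 2 => exact Emits.const (encodeVar n)

theorem emits_literal {v : (Fin K → ℕ) → ℕ}
    (hv : Emits b m P (fun _ _ _ σ => encodeVar (v σ) : Emission α Token K))
    (I : Fin T.N → Bool) (c : Bool) : EmitsText b m P (encode code)
      (fun _ _ _ σ => T.literal I c (v σ) : List α → ℕ → ℕ → (Fin K → ℕ) → Formula S) :=
  (EmitsPrefix.foldr _ fun _ => emitsPrefix_conn _ (emits_atom hv _)).emitsText (emits_atom hv _)

/-- The text of the translation of a quantified Boolean formula. -/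
noncomputable def text (code : S.Symbol → List Bool) (T : Frame S) (I : Fin T.N → Bool)
    (φ : QBF (QVar ι)) : List Token :=
  encode code (T.translate T.index I φ)

theorem emits_index (hm : m < K) {i : Fin K} (hi : i < m) (κ : Kind ι) :
    Emits b m P (fun _ _ _ σ => encodeVar (T.index (κ, σ i)) : Emission α Token K) :=
  emits_encodeVar hm hi (T.width ι) (T.offset κ)

variable {I : Fin T.N → Bool} {φ : List α → ℕ → ℕ → (Fin K → ℕ) → QBF (QVar ι)}
  {v : List α → ℕ → ℕ → (Fin K → ℕ) → QVar ι}

theorem emitsText_lit (hm : m < K) {i : Fin K} (hi : i < m) (κ : Kind ι) (c : Bool) :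
    EmitsText b m P (T.text code I)
      (fun _ _ _ σ => .lit c (κ, σ i) : List α → ℕ → ℕ → (Fin K → ℕ) → QBF (QVar ι)) :=
  emits_literal (emits_index hm hi κ) I c

theorem emitsPrefix_and (hφ : EmitsText b m P (T.text code I) φ) :
    EmitsPrefix b m P (T.text code I) fun w L h σ => (φ w L h σ).and :=
  (emitsPrefix_conn T.p hφ).of_semiconj fun _ _ _ _ _ => rfl

theorem emitsPrefix_or (hφ : EmitsText b m P (T.text code I) φ) :
    EmitsPrefix b m P (T.text code I) fun w L h σ => (φ w L h σ).or :=
  (emitsPrefix_conn (!T.p) hφ).of_semiconj fun _ _ _ _ _ => rfl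

theorem emitsPrefix_ex (hv : EmitsText b m P (fun v => encodeVar (T.index v)) v) :
    EmitsPrefix b m P (T.text code I) fun w L h σ => .ex (v w L h σ) :=
  (emitsPrefix_quant T.p hv).of_semiconj fun _ _ _ _ _ => rfl

theorem emitsPrefix_all (hv : EmitsText b m P (fun v => encodeVar (T.index v)) v) :
    EmitsPrefix b m P (T.text code I) fun w L h σ => .all (v w L h σ) :=
  (emitsPrefix_quant (!T.p) hv).of_semiconj fun _ _ _ _ _ => rfl

end Frame

namespace Frame

open QBF QVar

variable {S : Signature} {code : S.Symbol → List Bool} {T : Frame S} {I : Fin T.N → Bool}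
  {α ι : Type} [Fintype ι] {K b : ℕ} [NeZero b] {m : ℕ} {P : ℕ → Prop}

theorem emitsText_cellIs (hm : m < K) {i : Fin K} (hi : i < m) (a : Fin 5) (x : ι → Bool) :
    EmitsText b m P (T.text code I)
      (fun _ _ _ σ => cellIs a x (σ i) : List α → ℕ → ℕ → (Fin K → ℕ) → QBF (QVar ι)) :=
  (EmitsPrefix.foldr _ fun s => emitsPrefix_and
    (emitsText_lit hm hi (some (a, s)) (x s))).emitsText (.const _)

theorem emitsPrefix_cells (hm : m < K) {F : ℕ → ℕ × ι → QBF (QVar ι) → QBF (QVar ι)}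
    (hF : ∀ s, EmitsPrefix b (m + 1) P (T.text code I) (fun _ L _ σ => F L (σ ⟨m, hm⟩, s) :
      List α → ℕ → ℕ → (Fin K → ℕ) → QBF (QVar ι) → QBF (QVar ι))) :
    EmitsPrefix b m P (T.text code I) (fun _ L _ _ φ => (cells ι (b ^ L)).foldr (F L) φ :
      List α → ℕ → ℕ → (Fin K → ℕ) → QBF (QVar ι) → QBF (QVar ι)) :=
  .range_flatMap_map hm _ (fun i s => (i, s)) hF

theorem emitsPrefix_exConfig (hm : m + 1 < K) (a : Fin 5) :
    EmitsPrefix b m P (T.text code I) (fun _ L _ _ => exConfig (b ^ L) a :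
      List α → ℕ → ℕ → (Fin K → ℕ) → QBF (QVar ι) → QBF (QVar ι)) :=
  emitsPrefix_cells (by lia) (F := fun _ p => .ex (bit a p.2 p.1)) fun s =>
    emitsPrefix_ex (emits_index hm (i := ⟨m, by lia⟩) (Nat.lt_succ_self m) (some (a, s)))

theorem emitsText_sameConfig (hm : m + 1 < K) (a c : Fin 5) :
    EmitsText b m P (T.text code I) (fun _ L _ _ => sameConfig (b ^ L) a c :
      List α → ℕ → ℕ → (Fin K → ℕ) → QBF (QVar ι)) := by
  refine (emitsPrefix_cells (by lia) (F := fun _ p => (same (bit a p.2 p.1) (bit c p.2 p.1)).and)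
    fun s => emitsPrefix_and ?_).emitsText (.const _)
  have hlit (d : Fin 5) := emitsText_lit (code := code) (I := I) (α := α) (b := b) (P := P)
    (i := ⟨m, by lia⟩) hm (Nat.lt_succ_self m) (some (d, s))
  have hboth (v : Bool) := (emitsPrefix_and (hlit a v)).emitsText (hlit c v)
  exact (emitsPrefix_or (hboth true)).emitsText (hboth false)

theorem emitsText_selectHalf (hm : m + 1 < K) :
    EmitsText b m P (T.text code I)
      (fun _ L _ _ => selectHalf (b ^ L) : List α → ℕ → ℕ → (Fin K → ℕ) → QBF (QVar ι)) := by
  have hbranch (v : Bool) (a c d : Fin 5) := (emitsPrefix_and (.const (.lit v half))).emitsText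
    ((emitsPrefix_and (emitsText_sameConfig (T := T) (code := code) (I := I) (α := α) (ι := ι)
      (b := b) (P := P) hm 3 a)).emitsText (emitsText_sameConfig hm c d))
  exact (emitsPrefix_or (hbranch true 0 4 2)).emitsText (hbranch false 2 4 1)

theorem emitsPrefix_level (hm : m + 1 < K) :
    EmitsPrefix b m P (T.text code I) (fun _ L _ _ => level (b ^ L) :
      List α → ℕ → ℕ → (Fin K → ℕ) → QBF (QVar ι) → QBF (QVar ι)) := by
  have hrelocate : EmitsPrefix b m P (T.text code I) (fun _ L _ _ => relocate (b ^ L) :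
      List α → ℕ → ℕ → (Fin K → ℕ) → QBF (QVar ι) → QBF (QVar ι)) :=
    (emitsPrefix_exConfig hm 0).comp ((emitsPrefix_exConfig hm 1).comp
      ((emitsPrefix_and (emitsText_sameConfig hm 0 3)).comp
        (emitsPrefix_and (emitsText_sameConfig hm 1 4))))
  exact (emitsPrefix_exConfig hm 2).comp ((emitsPrefix_all (.const half)).comp
    ((emitsPrefix_exConfig hm 3).comp ((emitsPrefix_exConfig hm 4).comp
      ((emitsPrefix_and (emitsText_selectHalf hm)).comp hrelocate))))

theorem emitsText_localStep (hm : m < K) {i j k : Fin K} (hi : i < m) (hj : j < m) (hk : k < m)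
    (g : LocalRule ι) : EmitsText b m P (T.text code I) (fun _ _ _ σ =>
      localStep g (σ i) (σ j) (σ k) : List α → ℕ → ℕ → (Fin K → ℕ) → QBF (QVar ι)) :=
  (EmitsPrefix.foldr _ fun _ => emitsPrefix_or
    ((emitsPrefix_and (emitsText_cellIs hm hi _ _)).emitsText
      ((emitsPrefix_and (emitsText_cellIs hm hj _ _)).emitsText
        ((emitsPrefix_and (emitsText_cellIs hm hk _ _)).emitsText
          (emitsText_cellIs hm hj _ _))))).emitsText (.const _)

theorem emitsText_globalStep (hm : m + 3 < K) (g : LocalRule ι) :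
    EmitsText b m P (T.text code I)
      (fun _ L _ _ => globalStep (b ^ L) g : List α → ℕ → ℕ → (Fin K → ℕ) → QBF (QVar ι)) := by
  have hstep := emitsText_localStep (T := T) (code := code) (I := I) (α := α) (b := b) (P := P) hm
    (i := ⟨m, by lia⟩) (j := ⟨m + 1, by lia⟩) (k := ⟨m + 2, by lia⟩) (by simp) (by simp) (by simp) g
  have hsucc := Emits.update_cyclicSucc (by lia) ⟨m, by lia⟩ (by simp)
    (Emits.update_cyclicSucc (by lia) ⟨m + 1, by lia⟩ (by simp) hstep)
  refine (EmitsPrefix.range (by lia) (F := fun L i =>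
    (localStep g i ((i + 1) % b ^ L) (((i + 1) % b ^ L + 1) % b ^ L)).and)
      (emitsPrefix_and (hsucc.congr fun w L h σ _ _ _ => ?_))).emitsText (.const _)
  have hne : (⟨m, by lia⟩ : Fin K) ≠ ⟨m + 1 + 1, by lia⟩ := Fin.ne_of_val_ne (by lia)
  simp [Function.update_of_ne hne]

theorem emitsText_reach (hm : m + 3 < K) (g : LocalRule ι) :
    EmitsText b m P (T.text code I)
      (fun _ L _ _ => reach (b ^ L) g : List α → ℕ → ℕ → (Fin K → ℕ) → QBF (QVar ι)) :=
  (emitsPrefix_cells (by lia) (F := fun L _ => level (b ^ L)) fun _ =>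
    emitsPrefix_level (by lia)).emitsText (emitsText_globalStep hm g)

theorem emitsText_final (hm : m + 1 < K) (acc : (ι → Bool) → Prop) :
    EmitsText b m P (T.text code I)
      (fun _ L _ _ => final (b ^ L) acc : List α → ℕ → ℕ → (Fin K → ℕ) → QBF (QVar ι)) :=
  (EmitsPrefix.range (by lia) (F := fun _ i => (cellAccepts acc i).and) (emitsPrefix_and
    ((EmitsPrefix.foldr _ fun _ => emitsPrefix_or (emitsText_cellIs hm (Nat.lt_succ_self m) _ _)
      ).emitsText (.const _)))).emitsText (.const _)

variable [Finite α] (init : InputCell α → Bool → ι → Bool)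

theorem emitsText_initial (hm : m + 1 < K) :
    EmitsText b m (fun h => h = 0) (T.text code I) (fun w L _ _ =>
      initial (b ^ L) (initialCells init w) : List α → ℕ → ℕ → (Fin K → ℕ) → QBF (QVar ι)) := by
  refine (EmitsPrefix.rangeInput (by lia) (F := fun x i =>
    (cellIs 0 (init x (decide (i = 0))) i).and) fun x => emitsPrefix_and ?_).emitsText (.const _)
  have hcell (c : Bool) := emitsText_cellIs (T := T) (code := code) (I := I) (α := α) (b := b)
    (P := fun _ => True) (i := ⟨m, by lia⟩) hm (Nat.lt_succ_self m) 0 (init x c)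
  refine (Emits.ite_zero ⟨m, by lia⟩ (hcell true) (hcell false)).congr fun w L h σ _ _ _ => ?_
  split_ifs with h0 <;> simp [h0]

theorem emitsText_accepts (hK : 3 < K) (g : LocalRule ι) (acc : (ι → Bool) → Prop) :
    EmitsText b 0 (fun h => h = 0) (T.text code I) (fun w L _ _ =>
      accepts (b ^ L) g acc (initialCells init w) :
        List α → ℕ → ℕ → (Fin K → ℕ) → QBF (QVar ι)) :=
  ((emitsPrefix_exConfig (by lia) 0).comp (emitsPrefix_exConfig (by lia) 1)).emitsText
    ((emitsPrefix_and (emitsText_initial init (by lia))).emitsText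
      ((emitsPrefix_and (emitsText_final (by lia) acc)).emitsText (emitsText_reach hK g)))

omit [Finite α] in
theorem emitsText_sentence (hm : m + 1 < K)
    {φ : List α → ℕ → ℕ → (Fin K → ℕ) → QBF (QVar ι)}
    (hφ : ∀ I, EmitsText b m P (T.text code I) φ) :
    EmitsText b m P (encode code) fun w L h σ => T.sentence (b ^ L) (φ w L h σ) := by
  have hquant (p : Bool) (i : ℕ) := emitsPrefix_quant (code := code) (b := b) (m := m) (P := P) p
    (v := (fun _ _ _ _ => i : List α → ℕ → ℕ → (Fin K → ℕ) → ℕ)) (.const i)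
  have hclosure := EmitsPrefix.range_flatMap_map (b := b) (P := P) (by lia : m < K)
    (List.range (T.width ι)) (fun i c => i * T.width ι + c) (F := fun _ => Formula.all) fun c =>
      emitsPrefix_quant (code := code) (α := α) false
        (emits_encodeVar hm (Nat.lt_succ_self m) (T.width ι) c)
  refine hclosure.emitsText (((hquant (!T.p) _).comp ((hquant (!T.p) _).comp
    ((emitsPrefix_conn (!T.p) (.const _)).comp (EmitsPrefix.foldr _ fun _ => hquant T.p _)))
      ).emitsText ((EmitsPrefix.foldr _ fun I => emitsPrefix_conn T.p (hφ I)).emitsText (.const _)))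

end Frame

/-! ### Hardness from a definable equivalence relation -/

theorem exists_forall_eval_le_pow (p : Polynomial ℕ) : ∃ d, ∀ n, p.eval n ≤ (n + 2) ^ d := by
  induction p using Polynomial.induction_on' with
  | add p q hp hq =>
    obtain ⟨d, hd⟩ := hp
    obtain ⟨d', hd'⟩ := hq
    refine ⟨max d d' + 1, fun n => ?_⟩
    have hle {k : ℕ} (hk : k ≤ max d d') : (n + 2) ^ k ≤ (n + 2) ^ max d d' :=
      Nat.pow_le_pow_right (by lia) hk
    calc (p + q).eval n = p.eval n + q.eval n := Polynomial.eval_add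
      _ ≤ (n + 2) ^ max d d' + (n + 2) ^ max d d' := Nat.add_le_add
          ((hd n).trans (hle (le_max_left d d'))) ((hd' n).trans (hle (le_max_right d d')))
      _ = (n + 2) ^ max d d' * 2 := (mul_two _).symm
      _ ≤ (n + 2) ^ (max d d' + 1) := Nat.mul_le_mul_left _ (by lia)
  | monomial k a =>
    refine ⟨a + k, fun n => ?_⟩
    rw [Polynomial.eval_monomial, pow_add]
    exact Nat.mul_le_mul (Nat.lt_pow_self (by lia)).le (Nat.pow_le_pow_left (by lia) k)

theorem pow_add_two_le {n l : ℕ} (hl : 1 ≤ l) (hn : n < 2 ^ l) (d : ℕ) :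
    (n + 2) ^ d ≤ (2 ^ (2 * d + 1)) ^ l := by
  have htwo : 2 ≤ 2 ^ l := Nat.le_self_pow (by lia) 2
  calc (n + 2) ^ d ≤ (2 ^ l * 2 ^ l) ^ d := Nat.pow_le_pow_left (by nlinarith) d
    _ = 2 ^ (2 * d * l) := by rw [← pow_add, ← pow_mul]; congr 1; ring
    _ ≤ 2 ^ ((2 * d + 1) * l) := Nat.pow_le_pow_right (by lia) (Nat.mul_le_mul_right l (by lia))
    _ = (2 ^ (2 * d + 1)) ^ l := pow_mul ..

namespace Frame

open QBF

variable {S : Signature} {code : S.Symbol → List Bool} (T : Frame S) {α : Type} [Finite α]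
  {X : Set (List α)}

theorem exists_logSpaceComputable_encode_sentence (hX : InPSPACE X) :
    ∃ (κ : Type) (_ : Fintype κ) (B : List α → ℕ) (φ : List α → QBF (QVar κ)),
      LogSpaceComputable (fun w => encode code (T.sentence (B w) (φ w))) ∧
      ∀ w, 0 < B w ∧ (φ w).Within {v | v.2 < B w} ∧
        ∀ β, (φ w).Sat β ↔ (w ∈ X ↔ T.p = true) := by
  obtain ⟨M, q, hM⟩ := hX
  have := M.finite_Q
  have := M.finite_Γ
  let _ : Fintype M.Cell := Fintype.ofFinite _
  obtain ⟨d, hd⟩ := exists_forall_eval_le_pow (2 * q + Polynomial.X + 5)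
  let b := 2 ^ (2 * d + 1)
  have hb : 2 ≤ b := Nat.le_self_pow (by lia) 2
  have : NeZero b := ⟨by lia⟩
  obtain ⟨len, hlen, hlog⟩ := (emitsText_sentence (code := code) (T := T) (K := 4) (b := b)
    (by lia) fun _ => emitsText_accepts M.initBits (by lia) M.bitRule
      (M.cellAccepting T.p)).logSpaceComputable (by lia) hb
  refine ⟨M.Cell, _, fun w => b ^ len w, fun w => accepts (b ^ len w) M.bitRule
    (M.cellAccepting T.p) (initialCells M.initBits w), hlog, fun w => ?_⟩
  have hpos : 0 < b ^ len w := Nat.pow_pos (by lia)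
  have : NeZero (b ^ len w) := ⟨hpos.ne'⟩
  refine ⟨hpos, within_accepts hpos _ _ _, fun β => sat_accepts.trans ?_⟩
  have hsize : 2 * q.eval w.length + w.length + 5 ≤ b ^ len w := by
    simpa using (hd w.length).trans (pow_add_two_le (hlen w).1 (hlen w).2 d)
  exact M.forall_cellAccepting_iterate_initialCells hM T.p w hsize

end Frame

theorem pspaceHard_of_definesEquivalence {S : Signature} (code : S.Symbol → List Bool)
    {A B : Model S} {L : Set Op} (hL : positiveOps ⊆ L) {θ : Formula S} (hops : θ.ops ⊆ L)
    (hfree : θ.freeVars ⊆ {0, 1}) (hbound : θ.boundVars ⊆ Set.Ici 2) {p : Bool}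
    (hA : θ.DefinesEquivalence A p) (hB : θ.DefinesEquivalence B p) :
    PSPACEHard (promiseMC code L A B) := by
  intro α _ X hX
  obtain ⟨E, hEne, hE⟩ := hA
  obtain ⟨F, hFne, hF⟩ := hB
  obtain ⟨r, hr⟩ := θ.finite_boundVars.bddAbove
  let T : Frame S :=
    { θ, p, r, N := max (Nat.card A.Carrier) (Nat.card B.Carrier)
      freeVars_subset := hfree
      boundVars_subset := fun x hx => ⟨hbound hx, hr hx⟩ }
  obtain ⟨κ, _, size, φ, hlog, hφ⟩ :=
    T.exists_logSpaceComputable_encode_sentence (code := code) hX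
  have hsent (w : List α) : (T.sentence (size w) (φ w)).IsSentence L :=
    T.isSentence_sentence (hφ w).1 hL hops (hφ w).2.1
  refine ⟨_, hlog, fun w hw => ⟨_, hsent w, ?_, rfl⟩, fun w hw => ⟨_, hsent w, ?_, rfl⟩⟩
  · exact (T.models_sentence hE hEne (le_max_left _ _) (hφ w).2.2 _).2 hw
  · exact fun h => hw ((T.models_sentence hF hFne (le_max_right _ _) (hφ w).2.2 _).1 h)

/-! ### Definable equivalence relations -/

theorem eq_univ_of_forall_update_mem {ι X : Type*} [Finite ι] [DecidableEq ι] {s : Set (ι → X)}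
    (hs : s.Nonempty) (hupdate : ∀ t ∈ s, ∀ i x, Function.update t i x ∈ s) : s = Set.univ := by
  obtain ⟨t, ht⟩ := hs
  cases nonempty_fintype ι
  refine Set.eq_univ_of_forall fun u => ?_
  have hpiecewise (c : Finset ι) : c.piecewise u t ∈ s := by
    induction c using Finset.induction_on with
    | empty => rwa [Finset.piecewise_empty]
    | insert i c _ ih => rw [Finset.piecewise_insert]; exact hupdate _ ih i (u i)
  simpa using hpiecewise Finset.univ

section indiscernible

variable {S : Signature} (A : Model S) (R : S.Symbol)

/-- Indiscernibility of two elements: exchanging them at any position of a tuple does not affect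
whether the tuple belongs to `R`. -/
def indiscernible : Setoid A.Carrier :=
  Setoid.ker fun x => {q : (Fin (S.arity R) → A.Carrier) × Fin (S.arity R) |
    Function.update q.1 q.2 x ∈ A.interp R}

variable {A R} in
theorem indiscernible_iff {x y : A.Carrier} : indiscernible A R x y ↔
    ∀ t k, Function.update t k x ∈ A.interp R ↔ Function.update t k y ∈ A.interp R := by
  change (_ : Set _) = _ ↔ _
  simp only [Set.ext_iff, Set.mem_ofPred_eq, Prod.forall]

theorem exists_not_indiscernible : ∃ x y, ¬ indiscernible A R x y := by
  by_contra! h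
  refine A.interp_proper R (eq_univ_of_forall_update_mem (A.interp_nonempty R) fun t ht k x => ?_)
  have := (indiscernible_iff.1 (h x (t k)) t k).2
  rw [Function.update_eq_self] at this
  exact this ht

variable {A R}

/-- The variables `2, 3, …` with the one at position `k` replaced by `i`. -/
def tupleVars {n : ℕ} (k : Fin n) (i : ℕ) : Fin n → ℕ :=
  Function.update (fun l => (l : ℕ) + 2) k i

/-- The formula stating that exchanging the elements `0` and `1` at position `k` does not affect
membership in `R`, whose complement is expressed by `N`. -/
def exchangeable (R : S.Symbol) (N : (Fin (S.arity R) → ℕ) → Formula S) (k : Fin (S.arity R)) :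
    Formula S :=
  .disj (.conj (.rel R (tupleVars k 0)) (.rel R (tupleVars k 1)))
    (.conj (N (tupleVars k 0)) (N (tupleVars k 1)))

/-- The formula that defines indiscernibility. -/
def indiscernibleFormula (R : S.Symbol) (N : (Fin (S.arity R) → ℕ) → Formula S) : Formula S :=
  .closure (List.range' 2 (S.arity R))
    ((List.finRange (S.arity R)).foldr (fun k => (exchangeable R N k).conj)
      (exchangeable R N ⟨0, S.arity_pos R⟩))

variable {N : (Fin (S.arity R) → ℕ) → Formula S}

theorem sat_exchangeable (hN : ∀ v e, (N v).Sat A e ↔ (fun k => e (v k)) ∉ A.interp R)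
    (k : Fin (S.arity R)) (e : ℕ → A.Carrier) : (exchangeable R N k).Sat A e ↔
      (Function.update (fun l : Fin (S.arity R) => e (l + 2)) k (e 0) ∈ A.interp R ↔
        Function.update (fun l : Fin (S.arity R) => e (l + 2)) k (e 1) ∈ A.interp R) := by
  have hval (i : ℕ) : (fun l => e (tupleVars k i l)) =
      Function.update (fun l : Fin (S.arity R) => e (l + 2)) k (e i) :=
    Function.comp_update e _ k i
  simp only [exchangeable, Formula.Sat, hN, hval]
  exact iff_iff_and_or_not_and_not.symm

theorem definesEquivalence_indiscernibleFormula
    (hN : ∀ v e, (N v).Sat A e ↔ (fun k => e (v k)) ∉ A.interp R) :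
    (indiscernibleFormula R N).DefinesEquivalence A true := by
  refine ⟨indiscernible A R, exists_not_indiscernible A R, fun e => ?_⟩
  have hconj (e : ℕ → A.Carrier) : Formula.Sat A ((List.finRange (S.arity R)).foldr
      (fun k => (exchangeable R N k).conj) (exchangeable R N ⟨0, S.arity_pos R⟩)) e ↔
        ∀ k, (exchangeable R N k).Sat A e :=
    (Formula.holds_foldr_conn (p := true) _ (exchangeable R N)).trans
      ⟨fun h k => h.1 k (List.mem_finRange k), fun h => ⟨fun k _ => h k, h _⟩⟩
  change Formula.Sat A (indiscernibleFormula R N) e ↔ _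
  rw [indiscernibleFormula, Formula.sat_closure, indiscernible_iff]
  simp only [hconj, sat_exchangeable hN]
  constructor
  · intro h t
    have hinj : Function.Injective fun l : Fin (S.arity R) => (l : ℕ) + 2 :=
      fun l l' hl => Fin.ext (Nat.add_right_cancel hl)
    have heq : Set.EqOn (Function.extend (fun l : Fin (S.arity R) => (l : ℕ) + 2) t e) e
        {y | y ∈ List.range' 2 (S.arity R)}ᶜ := by
      refine fun y hy => Function.extend_apply' _ _ _ ?_
      rintro ⟨l, rfl⟩
      exact hy (List.mem_range'_1.2 ⟨by lia, by lia⟩)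
    have hfixed := h _ heq
    rw [heq (by simp), heq (by simp)] at hfixed
    simpa only [hinj.extend_apply] using hfixed
  · intro h e' he'
    rw [he' (by simp), he' (by simp)]
    exact h _

theorem ops_indiscernibleFormula_subset {L : Set Op} (hL : positiveOps ⊆ L)
    (hN : ∀ v, (N v).ops ⊆ L) : (indiscernibleFormula R N).ops ⊆ L := by
  have hconj {φ ψ : Formula S} (hφ : φ.ops ⊆ L) (hψ : ψ.ops ⊆ L) : (φ.conj ψ).ops ⊆ L :=
    Formula.ops_conn_subset (p := true) hL hφ hψ
  have hexchangeable (k : Fin (S.arity R)) : (exchangeable R N k).ops ⊆ L :=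
    Formula.ops_conn_subset (p := false) hL
      (hconj (Set.empty_subset L) (Set.empty_subset L)) (hconj (hN _) (hN _))
  exact Formula.ops_closure_subset hL (List.foldrRecOn (motive := fun φ : Formula S => φ.ops ⊆ L)
    _ _ (hexchangeable _) fun _ h k _ => hconj (hexchangeable k) h) _

theorem freeVars_indiscernibleFormula_subset (hN : ∀ v, (N v).freeVars ⊆ Set.range v) :
    (indiscernibleFormula R N).freeVars ⊆ {0, 1} := by
  let vars : Set ℕ := {0, 1} ∪ {y | y ∈ List.range' 2 (S.arity R)}
  have hrange (k : Fin (S.arity R)) {i : ℕ} (hi : i ∈ ({0, 1} : Set ℕ)) :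
      Set.range (tupleVars k i) ⊆ vars := by
    rintro _ ⟨l, rfl⟩
    obtain rfl | hl := eq_or_ne l k
    · exact .inl (by rwa [tupleVars, Function.update_self])
    · rw [tupleVars, Function.update_of_ne hl]
      exact .inr (List.mem_range'_1.2 ⟨by lia, by lia⟩)
  have hexchangeable (k : Fin (S.arity R)) : (exchangeable R N k).freeVars ⊆ vars :=
    Set.union_subset
      (Set.union_subset (hrange k (by simp)) (hrange k (by simp)))
      (Set.union_subset ((hN _).trans (hrange k (by simp))) ((hN _).trans (hrange k (by simp))))
  rw [indiscernibleFormula, Formula.freeVars_closure, Set.sdiff_subset_iff, Set.union_comm]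
  exact List.foldrRecOn (motive := fun φ : Formula S => φ.freeVars ⊆ vars) _ _ (hexchangeable _)
    fun _ h k _ => Set.union_subset (hexchangeable k) h

theorem boundVars_indiscernibleFormula_subset (hN : ∀ v, (N v).boundVars = ∅) :
    (indiscernibleFormula R N).boundVars ⊆ Set.Ici 2 := by
  have hexchangeable (k : Fin (S.arity R)) : (exchangeable R N k).boundVars = ∅ := by
    simp [exchangeable, Formula.boundVars, hN]
  refine List.foldrRecOn (motive := fun φ : Formula S => φ.boundVars ⊆ Set.Ici 2) _ _ ?_
    fun _ h i hi => Set.insert_subset (List.mem_range'_1.1 hi).1 h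
  exact List.foldrRecOn (motive := fun φ : Formula S => φ.boundVars ⊆ Set.Ici 2) _ _
    (by simp [hexchangeable]) fun _ h k _ => Set.union_subset (by simp [hexchangeable]) h

end indiscernible

theorem definesEquivalence_equal {S : Signature} {A : Model S} :
    (Formula.equal 0 1).DefinesEquivalence A true :=
  have := A.nontrivial
  ⟨⊥, exists_pair_ne A.Carrier, fun _ => Iff.rfl⟩

theorem definesEquivalence_unequal {S : Signature} {A : Model S} :
    (Formula.unequal 0 1).DefinesEquivalence A false :=
  have := A.nontrivial
  ⟨⊥, exists_pair_ne A.Carrier, fun _ => not_not⟩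

section hardness

variable {S : Signature} (code : S.Symbol → List Bool) {A B : Model S} {L : Set Op}
  (hL : positiveOps ⊆ L)

include hL

theorem pspaceHard_of_complement {R : S.Symbol} {N : (Fin (S.arity R) → ℕ) → Formula S}
    (hops : ∀ v, (N v).ops ⊆ L) (hfree : ∀ v, (N v).freeVars ⊆ Set.range v)
    (hbound : ∀ v, (N v).boundVars = ∅)
    (hA : ∀ v e, (N v).Sat A e ↔ (fun k => e (v k)) ∉ A.interp R)
    (hB : ∀ v e, (N v).Sat B e ↔ (fun k => e (v k)) ∉ B.interp R) :
    PSPACEHard (promiseMC code L A B) :=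
  pspaceHard_of_definesEquivalence code hL (ops_indiscernibleFormula_subset hL hops)
    (freeVars_indiscernibleFormula_subset hfree) (boundVars_indiscernibleFormula_subset hbound)
    (definesEquivalence_indiscernibleFormula hA) (definesEquivalence_indiscernibleFormula hB)

theorem pspaceHard_of_closedUnderComplementation (h : ClosedUnderComplementation A B) :
    PSPACEHard (promiseMC code L A B) := by
  obtain ⟨R⟩ := S.nonempty
  obtain ⟨R', hR', hA, hB⟩ := h R
  exact pspaceHard_of_complement (R := R) (N := fun v => .rel R' fun k => v (Fin.cast hR' k))
    code hL (fun _ => Set.empty_subset L) (fun v => Set.range_comp_subset_range _ v) (fun _ => rfl)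
    (fun v e => hA fun k => e (v k)) (fun v e => hB fun k => e (v k))

theorem pspaceHard_of_neg_mem (h : Op.neg ∈ L) : PSPACEHard (promiseMC code L A B) := by
  obtain ⟨R⟩ := S.nonempty
  exact pspaceHard_of_complement (R := R) (N := fun v => .neg (.rel R v)) code hL
    (fun _ => Set.insert_subset h (Set.empty_subset L)) (fun _ => subset_rfl) (fun _ => rfl)
    (fun _ _ => Iff.rfl) (fun _ _ => Iff.rfl)

theorem pspaceHard_of_equal_mem (h : Op.equal ∈ L) : PSPACEHard (promiseMC code L A B) :=
  pspaceHard_of_definesEquivalence (θ := .equal 0 1) code hL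
    (Set.singleton_subset_iff.2 h) subset_rfl (Set.empty_subset _) definesEquivalence_equal
    definesEquivalence_equal

theorem pspaceHard_of_unequal_mem (h : Op.unequal ∈ L) : PSPACEHard (promiseMC code L A B) :=
  pspaceHard_of_definesEquivalence (θ := .unequal 0 1) code hL
    (Set.singleton_subset_iff.2 h) subset_rfl (Set.empty_subset _) definesEquivalence_unequal
    definesEquivalence_unequal

end hardness

end PMC

theorem mainTheorem7_general (S : PMC.Signature) (code : S.Symbol → List Bool) (A B : PMC.Model S)
    (L : Set PMC.Op) (hL : PMC.positiveOps ⊆ L)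
    (h : PMC.ClosedUnderComplementation A B ∨ PMC.positiveOps ⊂ L) :
    PMC.PSPACEHard (PMC.promiseMC code L A B) := by
  rcases h with h | h
  · exact PMC.pspaceHard_of_closedUnderComplementation code hL h
  obtain ⟨o, ho, hpos⟩ := Set.exists_of_ssubset h
  cases o with
  | equal => exact PMC.pspaceHard_of_equal_mem code hL ho
  | unequal => exact PMC.pspaceHard_of_unequal_mem code hL ho
  | neg => exact PMC.pspaceHard_of_neg_mem code hL ho
  | ex | all | conj | disj => exact absurd (by simp [PMC.positiveOps]) hpos

theorem mainTheorem7 (S : PMC.Signature) (code : S.Symbol → List Bool)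
    (hcode : Function.Injective code) (A B : PMC.Model S) :
    (PMC.IsTemplate PMC.positiveOps A B → PMC.ClosedUnderComplementation A B →
      PMC.PSPACEHard (PMC.promiseMC code PMC.positiveOps A B)) ∧
    (∀ L : Set PMC.Op, PMC.positiveOps ⊂ L → PMC.IsTemplate L A B →
      PMC.PSPACEHard (PMC.promiseMC code L A B)) :=
  ⟨fun _ h => mainTheorem7_general S code A B _ subset_rfl (.inl h),
    fun L hL _ => mainTheorem7_general S code A B L hL.subset (.inr hL)⟩
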